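/- A hypergraph $H$ consists of a finite vertex set $V(H)$, a finite edge set $E(H)$ and an incidence function assigning to each edge $e$ a set $i_H(e)\subseteq V(H)$ with $|i_H(e)|\ge 2$ (parallel edges are allowed). The degree $d_H(v)$ is the number of edges $e$ with $v\in i_H(e)$, and $\Delta(H)$ is the maximum degree (with $\Delta(\varnothing)=0$). A subhypergraph $H'$ of $H$ has $V(H')\subseteq V(H)$, $E(H')\subseteq E(H)$ and $i_{H'}=i_H|_{E(H')}$; it is induced if $E(H')=\{e\in E(H): i_H(e)\subseteq V(H')\}$. A non-empty hypergraph $H$ is connected if for every set $X$ with $\varnothing\ne X\subsetneq V(H)$ some edge is incident both with a vertex of $X$ and with a vertex of $V(H)\setminus X$. The coloring number $\mathrm{col}(H)$ is the least integer $k\ge 0$ such that every non-empty subhypergraph $H'$ of $H$ contains a vertex $v$ with $d_{H'}(v)<k$. A $p$-partition of $H$ is a sequence $(H_1,\dots,H_p)$ of pairwise vertex-disjoint, possibly empty, induced subhypergraphs of $H$ with $V(H)=V(H_1)\cup\dots\cup V(H_p)$. For a simple graph $G$ and an integer $t\ge 1$, $tG$ is the hypergraph obtained from $G$ by replacing each edge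 by $t$ parallel edges; $K_n$ and $C_n$ denote the complete graph and the cycle on $n$ vertices. Theorem. Let $H$ be a connected hypergraph with maximum degree $\Delta(H)=\Delta\ge 1$ that is not (isomorphic to) a $tK_n$ for some $t,n\ge 1$ and not a $tC_n$ for some $t\ge 1$ and odd $n\ge 3$. Let $p\ge 2$ and let $k_1,k_2,\dots,k_p$ be positive integers with $k_1+k_2+\dots+k_p\ge\Delta$. Then there is a $p$-partition $(H_1,H_2,\dots,H_p)$ of $H$ such that $\mathrm{col}(H_i)\le k_i$ and $\Delta(H_i)\le k_i$ for every $i\in\{1,\dots,p\}$. -/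

import Mathlib

/-- A finite hypergraph, possibly with parallel edges but without loops: a finite vertex set, a
finite edge set and an incidence function. The vertices are drawn from `α` and the edges from `β`;
the values of the incidence function outside the edge set play no role. -/
structure MultiHypergraph (α β : Type*) where
  /-- The vertex set. -/
  verts : Finset α
  /-- The edge set. -/
  edges : Finset β
  /-- The incidence function. -/
  inc : β → Finset α
  inc_subset : ∀ e ∈ edges, inc e ⊆ verts
  two_le_card_inc : ∀ e ∈ edges, 2 ≤ (inc e).card

namespace MultiHypergraph

variable {α β : Type*}

/-- `H'.IsSub H`: `H'` is a subhypergraph of `H`. -/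
def IsSub (H' H : MultiHypergraph α β) : Prop :=
  H'.verts ⊆ H.verts ∧ H'.edges ⊆ H.edges ∧ ∀ e ∈ H'.edges, H'.inc e = H.inc e

/-- `H'.IsInducedSub H`: `H'` is an induced subhypergraph of `H`, that is, its edges are exactly
the edges of `H` all of whose vertices lie in the vertex set of `H'`. -/
def IsInducedSub (H' H : MultiHypergraph α β) : Prop :=
  H'.IsSub H ∧ ∀ e ∈ H.edges, H.inc e ⊆ H'.verts → e ∈ H'.edges

/-- `H` is connected: it is non-empty and every non-empty proper subset of the vertex set is left
by some edge. -/
def Connected (H : MultiHypergraph α β) : Prop :=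
  H.verts.Nonempty ∧
    ∀ X : Finset α, X.Nonempty → X ⊂ H.verts →
      ∃ e ∈ H.edges, (∃ u ∈ H.inc e, u ∈ X) ∧ ∃ w ∈ H.inc e, w ∈ H.verts ∧ w ∉ X

open Classical in
/-- The degree of a vertex: the number of edges incident with it. -/
noncomputable def degree (H : MultiHypergraph α β) (v : α) : ℕ :=
  (H.edges.filter fun e => v ∈ H.inc e).card

/-- The maximum degree (`0` for the empty hypergraph). -/
noncomputable def maxDegree (H : MultiHypergraph α β) : ℕ :=
  H.verts.sup H.degree

/-- `H` is strictly `k`-degenerate: every non-empty subhypergraph has a vertex whose degree in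
that subhypergraph is less than `k`. -/
def StrictlyDegenerate (H : MultiHypergraph α β) (k : ℕ) : Prop :=
  ∀ H' : MultiHypergraph α β, H'.IsSub H → H'.verts.Nonempty → ∃ v ∈ H'.verts, H'.degree v < k

/-- The coloring number: the least `k` such that `H` is strictly `k`-degenerate. -/
noncomputable def col (H : MultiHypergraph α β) : ℕ :=
  sInf {k | H.StrictlyDegenerate k}

theorem degree_le_maxDegree (H : MultiHypergraph α β) {v : α} (hv : v ∈ H.verts) :
    H.degree v ≤ H.maxDegree :=
  Finset.le_sup (f := H.degree) hv

theorem IsSub.degree_le {H' H : MultiHypergraph α β} (h : H'.IsSub H) (v : α) :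
    H'.degree v ≤ H.degree v := by
  classical
  refine Finset.card_le_card fun e he => ?_
  simp only [Finset.mem_filter] at he ⊢
  exact ⟨h.2.1 he.1, h.2.2 e he.1 ▸ he.2⟩

theorem strictlyDegenerate_maxDegree_add_one (H : MultiHypergraph α β) :
    H.StrictlyDegenerate (H.maxDegree + 1) := by
  rintro H' h ⟨v, hv⟩
  exact ⟨v, hv, Nat.lt_succ_of_le ((h.degree_le v).trans (H.degree_le_maxDegree (h.1 hv)))⟩

/-- The minimum in the definition of the coloring number is attained. -/
theorem strictlyDegenerate_col (H : MultiHypergraph α β) : H.StrictlyDegenerate H.col :=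
  Nat.sInf_mem (s := {k | H.StrictlyDegenerate k})
    ⟨_, H.strictlyDegenerate_maxDegree_add_one⟩

/-- A `p`-partition of `H`: a sequence of `p` pairwise vertex-disjoint (possibly empty) induced
subhypergraphs whose vertex sets together cover the vertex set of `H`. -/
structure IsPartition (H : MultiHypergraph α β) {p : ℕ} (P : Fin p → MultiHypergraph α β) :
    Prop where
  induced : ∀ i, (P i).IsInducedSub H
  disjoint : ∀ i j, i ≠ j → Disjoint (P i).verts (P j).verts
  cover : (H.verts : Set α) = ⋃ i, ((P i).verts : Set α)

open Classical in
/-- The multiplicity of the pair `u`, `v`: the number of edges whose set of incident vertices is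
exactly `{u, v}`. -/
noncomputable def edgeMultiplicity (H : MultiHypergraph α β) (u v : α) : ℕ :=
  (H.edges.filter fun e => H.inc e = {u, v}).card

/-- `H.IsMultiple t G`: up to an isomorphism of the vertex set, `H` is the hypergraph `tG` obtained
from the simple graph `G` by replacing each edge by `t` parallel edges. -/
def IsMultiple (H : MultiHypergraph α β) (t : ℕ) {γ : Type*} (G : SimpleGraph γ) : Prop :=
  (∀ e ∈ H.edges, (H.inc e).card = 2) ∧
    ∃ φ : γ ≃ H.verts, ∀ x y : γ,
      (G.Adj x y → H.edgeMultiplicity (φ x) (φ y) = t) ∧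
      (x ≠ y → ¬ G.Adj x y → H.edgeMultiplicity (φ x) (φ y) = 0)

end MultiHypergraph

/-! A partition is read as a colouring of the vertices, and `k` is generalized to a capacity `f v i`
depending on both vertex and colour. A colouring is `Good` if every non-empty vertex set has a
vertex whose degree in its own colour class within that set is below its capacity; for capacities
`k` this gives `col ≤ k i` on the class of `i`.

If a good colouring exists, recolouring a vertex of too large colour degree decreases a potential of
Lovász type and preserves goodness, so a minimizer also satisfies the degree bounds
(`Good.exists_colourDegree_le`). It remains to show that a connected `H` without a good colouring is
one of the excluded hypergraphs.

The tool is a good colouring of all vertices but one, the hole. Since the degree of the hole `y` is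
at most its total capacity, not being able to colour `y` forces equality everywhere: each colour
degree of `y` equals its capacity and each edge at `y` is monochromatic off `y` (`Good.hole`). The
hole then moves to any neighbour `u`, with `y` taking the colour of `u` (`Good.move`). Moving it
around yields: an edge containing a non-separating vertex with two available colours has size two
(`Bad.card_inc_le_two`); and without cut vertices, `f v a` is at least the multiplicity of `uv`
whenever `a` is available at `u` (`BadPair.edgeMultiplicity_le`).

The second fact lets a vertex be deleted with any available colour, lowering its neighbours'
capacities. Induction on deletions, passing to end blocks when cut vertices appear, shows that the
capacities of a bad pair without cut vertices are supported on one colour or constant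
(`BadPair.isMono_or_isConst`). With two available colours the graph is complete or has at most two
neighbours at each vertex, with constant positive multiplicity. For the original constant
capacities, an end block would have a strictly smaller total at its cut vertex, contradicting this
dichotomy; so `H` has no cut vertex (`Connected.badPair`). In the second case it is a cycle, and odd
because the parity colouring of an even cycle is good. -/

namespace MultiHypergraph

/-! ### Capacitated colourings and moving holes -/

section Degeneracy

open Classical

variable {α β ι : Type*}

/-- The number of edges inside `T` that are incident with `v` and all of whose other vertices have
colour `i`. -/
noncomputable def colourDegree (H : MultiHypergraph α β) (c : α → ι) (T : Finset α) (i : ι)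
    (v : α) : ℕ :=
  (H.edges.filter fun e => v ∈ H.inc e ∧ H.inc e ⊆ T ∧ ∀ w ∈ H.inc e, w ≠ v → c w = i).card

/-- The degree of `v` in the subhypergraph induced by `T`. -/
noncomputable def degreeOn (H : MultiHypergraph α β) (T : Finset α) (v : α) : ℕ :=
  (H.edges.filter fun e => v ∈ H.inc e ∧ H.inc e ⊆ T).card

/-- The colouring `c` of `T` is `f`-good: every non-empty subset `U` of `T` contains a vertex `v`
whose degree in its colour class inside `U` is less than `f v (c v)`. -/
def Good (H : MultiHypergraph α β) (f : α → ι → ℕ) (c : α → ι) (T : Finset α) : Prop :=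
  ∀ U ⊆ T, U.Nonempty → ∃ v ∈ U, H.colourDegree c U (c v) v < f v (c v)

/-- No colouring of `S` is `f`-good. -/
def Bad (H : MultiHypergraph α β) (f : α → ι → ℕ) (S : Finset α) : Prop :=
  ∀ c : α → ι, ¬ H.Good f c S

/-- `W` is a union of components of `S` after the removal of `A`. -/
def ClosedOff (H : MultiHypergraph α β) (S A W : Finset α) : Prop :=
  ∀ e ∈ H.edges, H.inc e ⊆ S → (∃ w ∈ H.inc e, w ∈ W) → H.inc e ⊆ W ∪ A

/-- The set `A` does not separate `S`. -/
def ConnOff (H : MultiHypergraph α β) (S A : Finset α) : Prop :=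
  ∀ W ⊆ S \ A, W.Nonempty → H.ClosedOff S A W → W = S \ A

variable {H : MultiHypergraph α β} {f : α → ι → ℕ} {c c' : α → ι} {S T T' : Finset α}

theorem colourDegree_mono (h : T ⊆ T') (i : ι) (v : α) :
    H.colourDegree c T i v ≤ H.colourDegree c T' i v := by
  refine Finset.card_le_card fun e he => ?_
  simp only [Finset.mem_filter] at he ⊢
  exact ⟨he.1, he.2.1, he.2.2.1.trans h, he.2.2.2⟩

theorem colourDegree_congr {v : α} (h : ∀ w ∈ T, w ≠ v → c w = c' w) (i : ι) :
    H.colourDegree c T i v = H.colourDegree c' T i v := by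
  unfold colourDegree
  congr 1
  refine Finset.filter_congr fun e _ => ?_
  refine and_congr_right fun _ => and_congr_right fun hT => ?_
  refine forall_congr' fun _ => forall_congr' fun hw => forall_congr' fun hwv => ?_
  rw [h _ (hT hw) hwv]

theorem colourDegree_update (v : α) (i j : ι) :
    H.colourDegree (Function.update c v j) T i v = H.colourDegree c T i v :=
  colourDegree_congr (fun _ _ hw => Function.update_of_ne hw _ _) i

theorem Good.subset (h : H.Good f c T') (hT : T ⊆ T') : H.Good f c T :=
  fun U hU => h U (hU.trans hT)

theorem Good.congr (h : H.Good f c T) (hc : ∀ w ∈ T, c w = c' w) : H.Good f c' T := by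
  intro U hU hne
  obtain ⟨v, hv, hlt⟩ := h U hU hne
  refine ⟨v, hv, ?_⟩
  rwa [← hc v (hU hv), ← colourDegree_congr (c := c) (fun w hw _ => hc w (hU hw))]

theorem good_empty : H.Good f c ∅ := by
  intro U hU hne
  rw [Finset.subset_empty.1 hU] at hne
  exact absurd hne Finset.not_nonempty_empty

/-- The vertex `y` can be peeled off first: it is the witness for every subset that contains it,
because colour degrees are monotone in the set. -/
theorem Good.of_erase {y : α} (h : H.Good f c (T.erase y))
    (hlt : H.colourDegree c T (c y) y < f y (c y)) : H.Good f c T := by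
  intro U hU hne
  by_cases hy : y ∈ U
  · exact ⟨y, hy, (colourDegree_mono hU _ _).trans_lt hlt⟩
  · exact h U (fun w hw => Finset.mem_erase.2 ⟨fun h => hy (h ▸ hw), hU hw⟩) hne

theorem exists_ne_of_mem_edges {e : β} (he : e ∈ H.edges) (v : α) : ∃ w ∈ H.inc e, w ≠ v := by
  have := H.two_le_card_inc e he
  exact Finset.exists_mem_ne (by omega) v

/-- An edge has a vertex besides `y`, and the colour of that vertex determines the class; this uses
that edges have at least two vertices. -/
theorem pairwiseDisjoint_colourEdges [Fintype ι] (c : α → ι) (T : Finset α) (y : α) :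
    ((Finset.univ : Finset ι) : Set ι).PairwiseDisjoint fun i =>
      H.edges.filter fun e => y ∈ H.inc e ∧ H.inc e ⊆ T ∧ ∀ w ∈ H.inc e, w ≠ y → c w = i := by
  intro i _ j _ hij
  rw [Function.onFun, Finset.disjoint_left]
  intro e hi hj
  simp only [Finset.mem_filter] at hi hj
  obtain ⟨w, hw, hwy⟩ := exists_ne_of_mem_edges hi.1 y
  exact hij ((hi.2.2.2 w hw hwy).symm.trans (hj.2.2.2 w hw hwy))

theorem sum_colourDegree_le [Fintype ι] (c : α → ι) (T : Finset α) (y : α) :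
    ∑ i, H.colourDegree c T i y ≤ H.degreeOn T y := by
  unfold colourDegree
  rw [← Finset.card_biUnion (pairwiseDisjoint_colourEdges c T y)]
  refine Finset.card_le_card fun e he => ?_
  simp only [Finset.mem_biUnion, Finset.mem_filter, Finset.mem_univ, true_and] at he ⊢
  obtain ⟨i, he⟩ := he
  exact ⟨he.1, he.2.1, he.2.2.1⟩

/-- Suppose a good colouring of `T` cannot be extended to `y`. Then every colour degree of `y` equals
its capacity, and every edge at `y` lies in `T ∪ {y}` and is monochromatic off `y`. -/
theorem Good.hole [Fintype ι] {y : α} (hc : H.Good f c T) (hT : T ⊆ S) (hyT : y ∉ T) (hy : y ∈ S)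
    (hbad : H.Bad f (insert y T)) (hdeg : H.degreeOn S y ≤ ∑ i, f y i) :
    (∀ i, H.colourDegree c (insert y T) i y = f y i) ∧
      (∀ e ∈ H.edges, y ∈ H.inc e → H.inc e ⊆ S →
        H.inc e ⊆ insert y T ∧ ∃ i, ∀ w ∈ H.inc e, w ≠ y → c w = i) ∧
      H.degreeOn S y = ∑ i, f y i := by
  -- A colour with spare capacity at `y` would extend the good colouring to `y`.
  have hle : ∀ i, f y i ≤ H.colourDegree c (insert y T) i y := by
    intro i
    by_contra hlt
    push Not at hlt
    apply hbad (Function.update c y i)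
    apply Good.of_erase (y := y)
    · rw [Finset.erase_insert hyT]
      exact hc.congr fun w hw => (Function.update_of_ne (ne_of_mem_of_not_mem hw hyT) _ _).symm
    · rw [Function.update_self, colourDegree_update]
      exact hlt
  set A : ι → Finset β := fun i =>
    H.edges.filter fun e => y ∈ H.inc e ∧ H.inc e ⊆ insert y T ∧
      ∀ w ∈ H.inc e, w ≠ y → c w = i with hA
  set D : Finset β := H.edges.filter fun e => y ∈ H.inc e ∧ H.inc e ⊆ S with hD
  have hcard : (Finset.univ.biUnion A).card = ∑ i, (A i).card :=
    Finset.card_biUnion (pairwiseDisjoint_colourEdges c _ y)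
  have hsub : Finset.univ.biUnion A ⊆ D := by
    intro e he
    simp only [hA, hD, Finset.mem_biUnion, Finset.mem_univ, true_and, Finset.mem_filter] at he ⊢
    obtain ⟨i, he⟩ := he
    exact ⟨he.1, he.2.1, he.2.2.1.trans (Finset.insert_subset hy hT)⟩
  have hsum : ∑ i, f y i ≤ ∑ i, (A i).card := Finset.sum_le_sum fun i _ => hle i
  have h1 : D.card ≤ ∑ i, f y i := hdeg
  have h2 := Finset.card_le_card hsub
  -- The chain `∑ f y i ≤ ∑ |A i| = |⋃ A i| ≤ |D| ≤ ∑ f y i` collapses to equalities.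
  have hEq : Finset.univ.biUnion A = D := Finset.eq_of_subset_of_card_le hsub (by omega)
  refine ⟨?_, ?_, le_antisymm hdeg (hsum.trans (hcard.symm.trans_le h2))⟩
  · have := (Finset.sum_eq_sum_iff_of_le (s := Finset.univ) (f := f y) (g := fun i => (A i).card)
      fun i _ => hle i).1 (by omega)
    exact fun i => (this i (Finset.mem_univ i)).symm
  · intro e he hye heS
    have : e ∈ Finset.univ.biUnion A := by
      rw [hEq]
      exact Finset.mem_filter.2 ⟨he, hye, heS⟩
    simp only [hA, Finset.mem_biUnion, Finset.mem_univ, true_and, Finset.mem_filter] at this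
    obtain ⟨i, he⟩ := this
    exact ⟨he.2.2.1, i, he.2.2.2⟩

/-- Uncolouring a neighbour `u` of the hole `y` makes room for colouring `y` with the colour
of `u`. -/
theorem Good.move {y u : α} {e : β} (hc : H.Good f c T)
    (hdeg : ∀ i, H.colourDegree c (insert y T) i y = f y i) (he : e ∈ H.edges)
    (hye : y ∈ H.inc e) (heT : H.inc e ⊆ insert y T) (hu : u ∈ H.inc e) (huy : u ≠ y)
    (hmono : ∃ i, ∀ w ∈ H.inc e, w ≠ y → c w = i) :
    H.Good f (Function.update c y (c u)) ((insert y T).erase u) := by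
  apply Good.of_erase (y := y)
  · refine Good.congr (c := c) (hc.subset ?_) ?_
    · intro w hw
      simp only [Finset.mem_erase, Finset.mem_insert] at hw
      tauto
    · intro w hw
      exact (Function.update_of_ne (Finset.ne_of_mem_erase hw) _ _).symm
  · rw [Function.update_self, colourDegree_update, ← hdeg]
    -- The edge `e` was counted in the colour of `u` and is lost with `u`, so the colour degree of
    -- `y` falls strictly below its capacity.
    refine Finset.card_lt_card ⟨fun g hg => ?_, fun h => ?_⟩
    · simp only [Finset.mem_filter] at hg ⊢
      exact ⟨hg.1, hg.2.1, hg.2.2.1.trans (Finset.erase_subset _ _), hg.2.2.2⟩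
    · obtain ⟨i, hi⟩ := hmono
      have := h (Finset.mem_filter.2
        ⟨he, hye, heT, fun w hw hwy => (hi w hw hwy).trans (hi u hu huy).symm⟩)
      simp only [Finset.mem_filter] at this
      exact Finset.notMem_erase u _ (this.2.2.1 hu)

section Hole

variable [Fintype ι]

/-- Everything known about a bad pair with a hole at `y`. -/
theorem Good.hole' {y : α} (hc : H.Good f c (S.erase y)) (hy : y ∈ S) (hbad : H.Bad f S)
    (hdeg : H.degreeOn S y ≤ ∑ i, f y i) :
    (∀ i, H.colourDegree c S i y = f y i) ∧
      ∀ e ∈ H.edges, y ∈ H.inc e → H.inc e ⊆ S →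
        ∃ i, ∀ w ∈ H.inc e, w ≠ y → c w = i := by
  have := hc.hole (S := S) (Finset.erase_subset _ _) (Finset.notMem_erase _ _) hy
    (by rwa [Finset.insert_erase hy]) hdeg
  rw [Finset.insert_erase hy] at this
  exact ⟨this.1, fun e h1 h2 h3 => (this.2.1 e h1 h2 h3).2⟩

theorem Good.move' {y u : α} {e : β} (hc : H.Good f c (S.erase y)) (hy : y ∈ S)
    (hbad : H.Bad f S) (hdeg : H.degreeOn S y ≤ ∑ i, f y i) (he : e ∈ H.edges)
    (hye : y ∈ H.inc e) (heS : H.inc e ⊆ S) (hu : u ∈ H.inc e) (huy : u ≠ y) :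
    H.Good f (Function.update c y (c u)) (S.erase u) := by
  have h := hc.hole' hy hbad hdeg
  have := Good.move (T := S.erase y) hc
    (by rw [Finset.insert_erase hy]; exact h.1) he hye (by rwa [Finset.insert_erase hy]) hu huy
    (h.2 e he hye heS)
  rwa [Finset.insert_erase hy] at this

/-- A connected bad pair has a good colouring with a hole at any prescribed vertex. -/
theorem Bad.exists_hole (hbad : H.Bad f S) (hconn : H.ConnOff S ∅)
    (hdeg : ∀ v ∈ S, H.degreeOn S v ≤ ∑ i, f v i) (hι : Nonempty ι) {z : α} (hz : z ∈ S) :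
    ∃ c, H.Good f c (S.erase z) := by
  -- A largest well-coloured `T` makes each of its one-vertex extensions bad, so holes can move even
  -- before `T` is known to miss only one vertex.
  have hset : (S.powerset.filter fun T => ∃ c, H.Good f c T).Nonempty :=
    ⟨∅, by simpa using ⟨fun _ => hι.some, good_empty⟩⟩
  obtain ⟨T, hT, hmax⟩ := Finset.exists_max_image _ Finset.card hset
  simp only [Finset.mem_filter, Finset.mem_powerset, and_imp, forall_exists_index] at hT hmax
  obtain ⟨hTS, c, hc⟩ := hT
  have hbig : ∀ T' ⊆ S, T.card < T'.card → H.Bad f T' := by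
    intro T' hT' hlt c' hc'
    have := hmax T' hT' c' hc'
    omega
  have step : ∀ (T' : Finset α) (c' : α → ι) (y u : α) (e : β), T' ⊆ S → T'.card = T.card →
      H.Good f c' T' → y ∈ S → y ∉ T' → e ∈ H.edges → y ∈ H.inc e → H.inc e ⊆ S → u ∈ H.inc e →
      u ≠ y → u ∈ T' ∧ ∃ c'', H.Good f c'' ((insert y T').erase u) := by
    intro T' c' y u e hT' hcard hc' hy hyT he hye heS hu huy
    have hb : H.Bad f (insert y T') := by
      apply hbig _ (Finset.insert_subset hy hT')
      rw [Finset.card_insert_of_notMem hyT]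
      omega
    have h := hc'.hole hT' hyT hy hb (hdeg y hy)
    have h2 := h.2.1 e he hye heS
    exact ⟨(Finset.mem_insert.1 (h2.1 hu)).resolve_left huy, _,
      hc'.move h.1 he hye h2.1 hu huy h2.2⟩
  obtain ⟨y, hyS, hyT⟩ : ∃ y ∈ S, y ∉ T := by
    by_contra hcon
    push Not at hcon
    exact hbad c (hc.subset hcon)
  have hTy : T = S.erase y := by
    refine Finset.Subset.antisymm (fun w hw => Finset.mem_erase.2 ⟨fun h => hyT (h ▸ hw), hTS hw⟩) ?_
    intro y' hy'
    by_contra hy'T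
    rw [Finset.mem_erase] at hy'
    -- Suppose there were a second hole `y'`. The positions reachable by the first while `y'` stays
    -- uncoloured are closed under edges, since two holes never share an edge; by connectedness they
    -- would include `y'` itself.
    set R := S.filter fun w => w ≠ y' ∧ ∃ T' ⊆ S, T'.card = T.card ∧ w ∉ T' ∧ y' ∉ T' ∧
      ∃ c', H.Good f c' T' with hR
    have hRS : R = S \ ∅ := by
      refine hconn R (by simp [hR]) ⟨y, ?_⟩ ?_
      · simp only [hR, Finset.mem_filter]
        exact ⟨hyS, hy'.1.symm, T, hTS, rfl, hyT, hy'T, c, hc⟩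
      · rintro e he heS ⟨w, hwe, hwR⟩ u hu
        rw [Finset.union_empty]
        by_cases huw : u = w
        · exact huw ▸ hwR
        simp only [hR, Finset.mem_filter] at hwR ⊢
        obtain ⟨hwS, hwy, T', hT', hcard, hwT, hyT', c', hc'⟩ := hwR
        obtain ⟨huT, c'', hc''⟩ := step T' c' w u e hT' hcard hc' hwS hwT he hwe heS hu huw
        refine ⟨heS hu, fun h => hyT' (h ▸ huT), _, ?_, ?_, ?_, ?_, c'', hc''⟩
        · exact (Finset.erase_subset _ _).trans (Finset.insert_subset hwS hT')
        · rw [Finset.card_erase_of_mem (Finset.mem_insert_of_mem huT),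
            Finset.card_insert_of_notMem hwT, hcard]
          rfl
        · exact Finset.notMem_erase _ _
        · simp only [Finset.mem_erase, Finset.mem_insert, not_and, not_or]
          exact fun _ => ⟨hwy.symm, hyT'⟩
    have : y' ∈ R := by simpa [hRS] using hy'.2
    simp only [hR, Finset.mem_filter] at this
    exact this.2.1 rfl
  set R := S.filter fun w => ∃ c, H.Good f c (S.erase w) with hR
  have hRS : R = S \ ∅ := by
    refine hconn R (by simp [hR]) ⟨y, ?_⟩ ?_
    · simp only [hR, Finset.mem_filter]
      exact ⟨hyS, c, hTy ▸ hc⟩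
    · rintro e he heS ⟨w, hwe, hwR⟩ u hu
      rw [Finset.union_empty]
      by_cases huw : u = w
      · exact huw ▸ hwR
      simp only [hR, Finset.mem_filter] at hwR ⊢
      obtain ⟨hwS, c', hc'⟩ := hwR
      exact ⟨heS hu, _, hc'.move' hwS hbad (hdeg w hwS) he hwe heS hu huw⟩
  have : z ∈ R := by simpa [hRS] using hz
  simp only [hR, Finset.mem_filter] at this
  exact this.2

theorem Bad.degreeOn_eq (hbad : H.Bad f S) (hconn : H.ConnOff S ∅)
    (hdeg : ∀ v ∈ S, H.degreeOn S v ≤ ∑ i, f v i) (hι : Nonempty ι) {v : α} (hv : v ∈ S) :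
    H.degreeOn S v = ∑ i, f v i := by
  obtain ⟨c, hc⟩ := hbad.exists_hole hconn hdeg hι hv
  exact (hc.hole (Finset.erase_subset _ _) (Finset.notMem_erase _ _) hv
    (by rwa [Finset.insert_erase hv]) (hdeg v hv)).2.2

/-- The vertices that a hole can reach from a given colouring while the colours on `A` stay
fixed. -/
noncomputable def holeReach (H : MultiHypergraph α β) (f : α → ι → ℕ) (S : Finset α) (c : α → ι)
    (A : Finset α) : Finset α :=
  S.filter fun w => ∃ c', H.Good f c' (S.erase w) ∧ ∀ x ∈ A, x ≠ w → c' x = c x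

/-- Moving the hole off `w` recolours only `w`, and `w` lies outside `A`. -/
theorem Bad.holeReach_step {A : Finset α} (hbad : H.Bad f S)
    (hdeg : ∀ v ∈ S, H.degreeOn S v ≤ ∑ i, f v i) {w u : α} {e : β}
    (hw : w ∈ H.holeReach f S c A) (hwA : w ∉ A) (he : e ∈ H.edges) (heS : H.inc e ⊆ S)
    (hwe : w ∈ H.inc e) (hu : u ∈ H.inc e) : u ∈ H.holeReach f S c A := by
  by_cases huw : u = w
  · exact huw ▸ hw
  simp only [holeReach, Finset.mem_filter] at hw ⊢
  obtain ⟨hwS, c', hc', hA⟩ := hw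
  refine ⟨heS hu, _, hc'.move' hwS hbad (hdeg w hwS) he hwe heS hu huw, fun x hx hxu => ?_⟩
  have hxw : x ≠ w := fun h => hwA (h ▸ hx)
  rw [Function.update_of_ne hxw, hA x hx hxw]

/-- If `u` does not separate `S`, a hole can reach any other vertex while `u` keeps its colour. -/
theorem Bad.exists_hole_keeping (hbad : H.Bad f S)
    (hdeg : ∀ v ∈ S, H.degreeOn S v ≤ ∑ i, f v i) {u w z : α} (hconn : H.ConnOff S {u})
    (hw : w ∈ S) (hwu : w ≠ u) (hc : H.Good f c (S.erase w)) (hz : z ∈ S) (hzu : z ≠ u) :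
    ∃ c', H.Good f c' (S.erase z) ∧ c' u = c u := by
  have hwR : w ∈ H.holeReach f S c {u} := by
    simp only [holeReach, Finset.mem_filter]
    exact ⟨hw, c, hc, fun _ _ _ => rfl⟩
  have := hconn (H.holeReach f S c {u} \ {u})
    (Finset.sdiff_subset_sdiff (Finset.filter_subset _ _) subset_rfl)
    ⟨w, by simp [hwR, hwu]⟩ (by
      rintro e he heS ⟨x, hxe, hx⟩ y hy
      simp only [Finset.mem_sdiff, Finset.mem_singleton] at hx
      have := hbad.holeReach_step hdeg hx.1 (by simpa using hx.2) he heS hxe hy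
      by_cases hyu : y = u <;> simp [this, hyu])
  have hzR : z ∈ H.holeReach f S c {u} \ {u} := by
    rw [this]
    simp [hz, hzu]
  simp only [holeReach, Finset.mem_sdiff, Finset.mem_filter, Finset.mem_singleton] at hzR
  obtain ⟨⟨_, c', hc', h⟩, _⟩ := hzR
  exact ⟨c', hc', h u rfl hzu.symm⟩

/-- In a connected bad pair, an edge with at least three vertices contains no non-separating vertex
with two positive capacities. -/
theorem Bad.card_inc_le_two (hbad : H.Bad f S) (hconn : H.ConnOff S ∅)
    (hdeg : ∀ v ∈ S, H.degreeOn S v ≤ ∑ i, f v i) {e : β} (he : e ∈ H.edges) (heS : H.inc e ⊆ S)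
    {v : α} (hv : v ∈ H.inc e) (hsep : H.ConnOff S {v}) {a b : ι} (hab : a ≠ b)
    (ha : 1 ≤ f v a) (hb : 1 ≤ f v b) : (H.inc e).card ≤ 2 := by
  by_contra hcard
  push Not at hcard
  have hvS := heS hv
  obtain ⟨c, hc⟩ := hbad.exists_hole hconn hdeg ⟨a⟩ hvS
  have hh := hc.hole' hvS hbad (hdeg v hvS)
  obtain ⟨j, hj⟩ := hh.2 e he hv heS
  -- With the hole at `v`, the rest of `e` has colour `j`. Leaving `v` along an edge of another
  -- colour `i` gives `v` colour `i`, so `e` now carries two colours.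
  obtain ⟨i, hij, hi⟩ : ∃ i, i ≠ j ∧ 1 ≤ f v i := by
    by_cases h : a = j
    · exact ⟨b, fun h' => hab (h.trans h'.symm), hb⟩
    · exact ⟨a, h, ha⟩
  rw [← hh.1 i, Nat.one_le_iff_ne_zero, colourDegree, Finset.card_ne_zero] at hi
  obtain ⟨g, hg⟩ := hi
  simp only [Finset.mem_filter] at hg
  obtain ⟨hg, hvg, hgS, hgi⟩ := hg
  obtain ⟨y, hyg, hyv⟩ := exists_ne_of_mem_edges hg v
  have hyi := hgi y hyg hyv
  have hye : y ∉ H.inc e := fun h => hij (hyi.symm.trans (hj y h hyv))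
  have hc1 := hc.move' hvS hbad (hdeg v hvS) hg hvg hgS hyg hyv
  set c1 := Function.update c v (c y) with hc1def
  set R := H.holeReach f S c1 (H.inc e) with hR
  have hyR : y ∈ R := by
    simp only [hR, holeReach, Finset.mem_filter]
    exact ⟨hgS hyg, c1, hc1, fun _ _ _ => rfl⟩
  -- As `v` does not separate, the hole returns to `e` at some `w ≠ v` with the colours on the rest
  -- of `e` unchanged; otherwise its reach off `v` would be everything off `v`.
  obtain ⟨w, hwR, hwe, hwv⟩ : ∃ w ∈ R, w ∈ H.inc e ∧ w ≠ v := by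
    by_contra hcon
    push Not at hcon
    have := hsep (R \ {v}) (Finset.sdiff_subset_sdiff (Finset.filter_subset _ _) subset_rfl)
      ⟨y, by simp [hyR, hyv]⟩ (by
        rintro e' he' heS' ⟨x, hxe, hx⟩ x' hx'
        simp only [Finset.mem_sdiff, Finset.mem_singleton] at hx
        have := hbad.holeReach_step hdeg hx.1 (fun h => hx.2 (hcon x hx.1 h)) he' heS' hxe hx'
        by_cases hyu : x' = v
        · simp [hyu]
        · simp only [Finset.mem_union, Finset.mem_sdiff, Finset.mem_singleton]
          exact Or.inl ⟨this, hyu⟩)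
    obtain ⟨x, hxe, hxv⟩ := exists_ne_of_mem_edges he v
    have hxR : x ∈ R \ {v} := by
      rw [this]
      simp [heS hxe, hxv]
    exact hxv (hcon x (Finset.mem_sdiff.1 hxR).1 hxe)
  simp only [hR, holeReach, Finset.mem_filter] at hwR
  obtain ⟨hwS, c2, hc2, hagree⟩ := hwR
  obtain ⟨l, hl⟩ := (hc2.hole' hwS hbad (hdeg w hwS)).2 e he hwe heS
  -- A third vertex of `e` has colour `j` while `v` has colour `i`, so `e` is not monochromatic off
  -- the hole `w`.
  obtain ⟨x, hxe, hxv, hxw⟩ : ∃ x ∈ H.inc e, x ≠ v ∧ x ≠ w := by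
    obtain ⟨x, hx⟩ : (H.inc e \ {v, w}).Nonempty := by
      rw [← Finset.card_pos]
      have := Finset.le_card_sdiff {v, w} (H.inc e)
      have := Finset.card_le_two (a := v) (b := w)
      omega
    simp only [Finset.mem_sdiff, Finset.mem_insert, Finset.mem_singleton, not_or] at hx
    exact ⟨x, hx.1, hx.2.1, hx.2.2⟩
  have h1 := hl x hxe hxw
  have h2 := hl v hv hwv.symm
  rw [hagree x hxe hxw, hc1def, Function.update_of_ne hxv, hj x hxe hxv] at h1
  rw [hagree v hv hwv.symm, hc1def, Function.update_self, hyi] at h2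
  exact hij (h2.trans h1.symm)

end Hole

end Degeneracy

/-! ### Cut vertices and end blocks -/

section Lobes

open Classical

variable {α β ι : Type*}

/-- `S` is connected and no vertex separates it. -/
def NoCut (H : MultiHypergraph α β) (S : Finset α) : Prop :=
  H.ConnOff S ∅ ∧ ∀ v ∈ S, H.ConnOff S {v}

/-- `X` is a proper non-empty union of components of `S - z`. -/
structure IsLobe (H : MultiHypergraph α β) (S X : Finset α) (z : α) : Prop where
  mem : z ∈ S
  subset : X ⊆ S \ {z}
  ne : X ≠ S \ {z}
  nonempty : X.Nonempty
  closed : H.ClosedOff S {z} X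

/-- `X` is a lobe that contains no smaller lobe. -/
def IsLeaf (H : MultiHypergraph α β) (S X : Finset α) (z : α) : Prop :=
  H.IsLobe S X z ∧ ∀ W z', H.IsLobe S W z' → W ⊆ X → W = X

variable {H : MultiHypergraph α β} {f : α → ι → ℕ} {c c' : α → ι} {S X T T' : Finset α} {z : α}

theorem ClosedOff.compl {A W : Finset α} (h : H.ClosedOff S A W) :
    H.ClosedOff S A ((S \ A) \ W) := by
  rintro e he heS ⟨w, hwe, hw⟩ x hx
  simp only [Finset.mem_sdiff, Finset.mem_union] at hw ⊢
  by_cases hxA : x ∈ A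
  · exact Or.inr hxA
  · refine Or.inl ⟨⟨heS hx, hxA⟩, fun hxW => ?_⟩
    have := h e he heS ⟨x, hx, hxW⟩ hwe
    rw [Finset.mem_union] at this
    tauto

theorem IsLobe.compl (h : H.IsLobe S X z) : H.IsLobe S ((S \ {z}) \ X) z where
  mem := h.mem
  subset := Finset.sdiff_subset
  ne := by
    intro hEq
    obtain ⟨x, hx⟩ := h.nonempty
    have : x ∈ (S \ {z}) \ X := by
      rw [hEq]
      exact h.subset hx
    exact (Finset.mem_sdiff.1 this).2 hx
  nonempty := by
    rw [Finset.sdiff_nonempty]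
    exact fun hsub => h.ne (Finset.Subset.antisymm h.subset hsub)
  closed := h.closed.compl

theorem IsLobe.exists_leaf (h : H.IsLobe S X z) : ∃ X' ⊆ X, ∃ z', H.IsLeaf S X' z' := by
  have hne : (X.powerset.filter fun W => ∃ z', H.IsLobe S W z').Nonempty :=
    ⟨X, Finset.mem_filter.2 ⟨Finset.mem_powerset_self X, z, h⟩⟩
  obtain ⟨W, hW, hmin⟩ := Finset.exists_min_image _ Finset.card hne
  simp only [Finset.mem_filter, Finset.mem_powerset] at hW hmin
  obtain ⟨hWX, z', hz'⟩ := hW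
  refine ⟨W, hWX, z', hz', fun W' z'' h' hsub => ?_⟩
  exact Finset.eq_of_subset_of_card_le hsub (hmin W' ⟨hsub.trans hWX, z'', h'⟩)

theorem exists_lobe_of_not_noCut (hconn : H.ConnOff S ∅) (h : ¬ H.NoCut S) :
    ∃ X z, H.IsLobe S X z := by
  simp only [NoCut, hconn, true_and, not_forall] at h
  obtain ⟨z, hz, h⟩ := h
  simp only [ConnOff, not_forall] at h
  obtain ⟨X, h1, h2, h3, h4⟩ := h
  exact ⟨X, z, hz, h1, h4, h2, h3⟩

theorem IsLobe.notMem (h : H.IsLobe S X z) : z ∉ X := fun hz => by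
  simpa using h.subset hz

theorem IsLobe.subset' (h : H.IsLobe S X z) : X ⊆ S := h.subset.trans Finset.sdiff_subset

/-- Some edge at the cut vertex of a lobe leaves the lobe. -/
theorem IsLobe.exists_edge (h : H.IsLobe S X z) (hconn : H.ConnOff S ∅) :
    ∃ e ∈ H.edges, H.inc e ⊆ S ∧ z ∈ H.inc e ∧ ∃ w ∈ H.inc e, w ∈ X := by
  by_contra hcon
  push Not at hcon
  have hX : X = S \ ∅ := by
    refine hconn X (by simpa using h.subset') h.nonempty ?_
    rintro e he heS ⟨w, hwe, hw⟩ x hx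
    have := h.closed e he heS ⟨w, hwe, hw⟩ hx
    rw [Finset.mem_union, Finset.mem_singleton] at this
    rcases this with this | rfl
    · simpa using this
    · exact absurd hw (hcon e he heS hx w hwe)
  rw [Finset.sdiff_empty] at hX
  exact h.notMem (hX ▸ h.mem)

/-- A vertex of a leaf does not separate. -/
theorem IsLeaf.connOff (h : H.IsLeaf S X z) (hconn : H.ConnOff S ∅) {v : α} (hv : v ∈ X) :
    H.ConnOff S {v} := by
  have hvS := h.1.subset' hv
  have hvz : v ≠ z := fun hh => h.1.notMem (hh ▸ hv)
  -- A lobe at `v` that avoids `z` would lie in `X`, since its part outside `X` is closed in the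
  -- connected set `S`; this contradicts minimality of `X`. But a lobe and its complementary lobe
  -- cannot both contain `z`.
  have key : ∀ W, H.IsLobe S W v → z ∈ W := by
    intro W hW
    by_contra hzW
    have hWX : W ⊆ X := by
      have hclosed : H.ClosedOff S ∅ (W \ X) := by
        rintro e he heS ⟨w, hwe, hw⟩ x hx
        rw [Finset.mem_sdiff] at hw
        have hwz : w ≠ z := fun hh => hzW (hh ▸ hw.1)
        have h1 := hW.closed e he heS ⟨w, hwe, hw.1⟩ hx
        have h2 := h.1.closed.compl e he heS ⟨w, hwe, by simp [hw.2, heS hwe, hwz]⟩ hx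
        simp only [Finset.mem_union, Finset.mem_singleton, Finset.mem_sdiff,
          Finset.notMem_empty, or_false] at h1 h2 ⊢
        rcases h1 with h1 | rfl
        · rcases h2 with h2 | rfl
          · exact ⟨h1, h2.2⟩
          · exact absurd h1 hzW
        · rcases h2 with h2 | h2
          · exact absurd hv h2.2
          · exact absurd h2 hvz
      by_contra hsub
      have := hconn (W \ X) (by simpa using Finset.sdiff_subset.trans hW.subset')
        (Finset.sdiff_nonempty.2 hsub) hclosed
      have : v ∈ W \ X := by simpa [this] using hvS
      exact hW.notMem (Finset.mem_sdiff.1 this).1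
    have := h.2 W v hW hWX
    exact hW.notMem (this ▸ hv)
  by_contra hcon
  simp only [ConnOff, not_forall] at hcon
  obtain ⟨W, h1, h2, h3, h4⟩ := hcon
  have hW : H.IsLobe S W v := ⟨hvS, h1, h4, h2, h3⟩
  have := key _ hW.compl
  exact (Finset.mem_sdiff.1 this).2 (key _ hW)

/-- A leaf together with its cut vertex has no cut vertex. -/
theorem IsLeaf.noCut (h : H.IsLeaf S X z) (hconn : H.ConnOff S ∅) : H.NoCut (insert z X) := by
  have hBS : insert z X ⊆ S := Finset.insert_subset h.1.mem h.1.subset'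
  have up : ∀ (A W : Finset α), W ⊆ X → H.ClosedOff (insert z X) A W → H.ClosedOff S A W := by
    rintro A W hWX hcl e he heS ⟨w, hwe, hw⟩
    refine hcl e he ?_ ⟨w, hwe, hw⟩
    refine (h.1.closed e he heS ⟨w, hwe, hWX hw⟩).trans ?_
    intro x
    simp only [Finset.mem_union, Finset.mem_singleton, Finset.mem_insert]
    tauto
  -- Closed sets of the block lying inside `X` are closed in `S`. So for `v ≠ z` such a set would
  -- have to contain `z`, and for `v = z` minimality of the leaf makes it `X`. Sets containing `z`
  -- are handled below through complements.
  have key : ∀ v ∈ S, H.ConnOff S {v} ∨ v = z → ∀ W ⊆ X \ {v}, W.Nonempty →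
      H.ClosedOff (insert z X) {v} W → W = X ∧ v = z := by
    intro v hvS hv W hWX hW hcl
    have hWX' := hWX.trans Finset.sdiff_subset
    have hcl' := up {v} W hWX' hcl
    by_cases hvz : v = z
    · subst hvz
      refine ⟨h.2 W v ⟨hvS, hWX'.trans h.1.subset, fun hEq => ?_, hW, hcl'⟩ hWX', rfl⟩
      exact h.1.ne (Finset.Subset.antisymm h.1.subset (hEq ▸ hWX'))
    · have hv' := hv.resolve_right hvz
      have hEq := hv' W (hWX.trans (Finset.sdiff_subset_sdiff h.1.subset' subset_rfl)) hW hcl'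
      have : z ∈ W := by
        rw [hEq]
        simp [h.1.mem, Ne.symm hvz]
      exact absurd (hWX' this) h.1.notMem
  have key0 : ∀ W ⊆ X, W.Nonempty → ¬ H.ClosedOff (insert z X) ∅ W := by
    intro W hWX hW hcl
    have := hconn W (by simpa using hWX.trans h.1.subset') hW (up ∅ W hWX hcl)
    have : z ∈ W := by
      rw [this]
      simp [h.1.mem]
    exact h.1.notMem (hWX this)
  constructor
  · intro W hW hne hcl
    by_contra hEq
    rw [Finset.sdiff_empty] at hW hEq
    by_cases hz : z ∈ W
    · refine key0 _ ?_ ?_ hcl.compl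
      · intro x hx
        simp only [Finset.sdiff_empty, Finset.mem_sdiff, Finset.mem_insert] at hx
        rcases hx.1 with rfl | h
        · exact absurd hz hx.2
        · exact h
      · rw [Finset.sdiff_empty, Finset.sdiff_nonempty]
        exact fun hsub => hEq (Finset.Subset.antisymm hW hsub)
    · refine key0 W ?_ hne hcl
      intro x hx
      exact (Finset.mem_insert.1 (hW hx)).resolve_left (fun hh => hz (hh ▸ hx))
  · intro v hv W hW hne hcl
    have hv' : H.ConnOff S {v} ∨ v = z := by
      rcases Finset.mem_insert.1 hv with h' | h'
      · exact Or.inr h'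
      · exact Or.inl (h.connOff hconn h')
    have hsub : ∀ U ⊆ insert z X \ {v}, z ∉ U → U ⊆ X \ {v} := by
      intro U hU hz x hx
      have := hU hx
      simp only [Finset.mem_sdiff, Finset.mem_insert, Finset.mem_singleton] at this ⊢
      exact ⟨this.1.resolve_left (fun hh => hz (hh ▸ hx)), this.2⟩
    by_cases hz : z ∈ W
    · by_contra hEq
      have := key v (hBS hv) hv' ((insert z X \ {v}) \ W)
        (hsub _ Finset.sdiff_subset (fun hh => (Finset.mem_sdiff.1 hh).2 hz))
        (Finset.sdiff_nonempty.2 fun hsub => hEq (Finset.Subset.antisymm hW hsub)) hcl.compl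
      have hzv := hW hz
      simp [this.2] at hzv
    · obtain ⟨h1, rfl⟩ := key v (hBS hv) hv' W (hsub W hW hz) hne hcl
      rw [h1]
      ext x
      simp only [Finset.mem_sdiff, Finset.mem_insert, Finset.mem_singleton]
      have := h.1.notMem
      constructor
      · exact fun hx => ⟨Or.inr hx, fun hh => this (hh ▸ hx)⟩
      · tauto

variable [Fintype ι]

/-- A bad pair induces a bad pair on every lobe, for a suitable capacity at the cut vertex. -/
theorem IsLobe.exists_bad (h : H.IsLobe S X z) (hbad : H.Bad f S) (hconn : H.ConnOff S ∅)
    (hdeg : ∀ v ∈ S, H.degreeOn S v ≤ ∑ i, f v i) (hι : Nonempty ι) :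
    ∃ x : ι → ℕ, H.Bad (Function.update f z x) (insert z X) ∧
      (∀ v ∈ insert z X, H.degreeOn (insert z X) v ≤ ∑ i, Function.update f z x v i) ∧
      (∀ i, x i ≤ f z i) ∧ ∑ i, x i < ∑ i, f z i := by
  obtain ⟨c0, hc0⟩ := hbad.exists_hole hconn hdeg hι h.mem
  have hh := hc0.hole' h.mem hbad (hdeg z h.mem)
  set B := insert z X with hB
  set Y := (S \ {z}) \ X with hY
  have hBS : B ⊆ S := Finset.insert_subset h.mem h.subset'
  have hXB : X ⊆ B := Finset.subset_insert z X
  have hsplit : ∀ (c : α → ι) (T : Finset α) (i : ι), T ⊆ S →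
      H.colourDegree c T i z =
        H.colourDegree c (T ∩ B) i z + H.colourDegree c (T \ X) i z := by
    intro c T i hT
    unfold colourDegree
    rw [← Finset.card_union_of_disjoint]
    · congr 1
      ext e
      simp only [Finset.mem_union, Finset.mem_filter]
      constructor
      · rintro ⟨he, hz, heT, hi⟩
        by_cases hX : ∃ w ∈ H.inc e, w ∈ X
        · refine Or.inl ⟨he, hz, Finset.subset_inter heT ?_, hi⟩
          refine (h.closed e he (heT.trans hT) hX).trans ?_
          rw [Finset.union_comm]
          exact subset_rfl
        · push Not at hX
          exact Or.inr ⟨he, hz, fun w hw => Finset.mem_sdiff.2 ⟨heT hw, hX w hw⟩, hi⟩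
      · rintro (⟨he, hz, heT, hi⟩ | ⟨he, hz, heT, hi⟩)
        · exact ⟨he, hz, heT.trans Finset.inter_subset_left, hi⟩
        · exact ⟨he, hz, heT.trans Finset.sdiff_subset, hi⟩
    · rw [Finset.disjoint_left]
      intro e h1 h2
      simp only [Finset.mem_filter] at h1 h2
      obtain ⟨w, hw, hwz⟩ := exists_ne_of_mem_edges h1.1 z
      have h3 := (Finset.mem_inter.1 (h1.2.2.1 hw)).2
      have h4 := (Finset.mem_sdiff.1 (h2.2.2.1 hw)).2
      exact h4 ((Finset.mem_insert.1 h3).resolve_left hwz)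
  have hSB : S ∩ B = B := Finset.inter_eq_right.2 hBS
  have hxy : ∀ i, H.colourDegree c0 B i z + H.colourDegree c0 (S \ X) i z = f z i := by
    intro i
    rw [← hh.1 i, hsplit c0 S i subset_rfl, hSB]
  -- Under a colouring with hole at `z`, the capacity of `z` splits into its colour degrees on the
  -- two sides of the cut; the share of the lobe is the new capacity.
  refine ⟨fun i => H.colourDegree c0 B i z, ?_, ?_, fun i => (Nat.le_add_right _ _).trans_eq (hxy i), ?_⟩
  · intro c hc
    -- A good colouring of the block is glued to `c0` outside. The colour degree of `z` beyond the
    -- block is at most the share removed from its capacity, so the result would be good on `S`.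
    set c' : α → ι := fun w => if w ∈ B then c w else c0 w with hc'
    have hcB : ∀ w ∈ B, c w = c' w := fun w hw => by simp [hc', hw]
    have hcY : ∀ w, w ∉ B → c0 w = c' w := fun w hw => by simp [hc', hw]
    apply hbad c'
    have hcase : ∀ T ⊆ S, ∀ v ∈ X, H.colourDegree c (T ∩ B) (c v) v < f v (c v) →
        H.colourDegree c' T (c' v) v < f v (c' v) := by
      intro T hT v hv hlt
      rw [← hcB v (hXB hv)]
      refine lt_of_le_of_lt (Finset.card_le_card fun e he => ?_) hlt
      simp only [Finset.mem_filter] at he ⊢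
      have heB : H.inc e ⊆ B := by
        refine (h.closed e he.1 (he.2.2.1.trans hT) ⟨v, he.2.1, hv⟩).trans ?_
        rw [Finset.union_comm]
        exact subset_rfl
      refine ⟨he.1, he.2.1, Finset.subset_inter he.2.2.1 heB, fun w hw hwv => ?_⟩
      rw [hcB w (heB hw)]
      exact he.2.2.2 w hw hwv
    intro T hT hne
    by_cases hz : z ∈ T
    · obtain ⟨v, hv, hlt⟩ := hc (T ∩ B) Finset.inter_subset_right
        ⟨z, Finset.mem_inter.2 ⟨hz, Finset.mem_insert_self _ _⟩⟩
      rw [Finset.mem_inter] at hv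
      by_cases hvz : v = z
      · subst hvz
        refine ⟨v, hv.1, ?_⟩
        rw [Function.update_self] at hlt
        rw [← hcB v hv.2, hsplit c' T _ hT, ← hxy]
        have h1 : H.colourDegree c' (T ∩ B) (c v) v = H.colourDegree c (T ∩ B) (c v) v :=
          (colourDegree_congr (fun w hw _ => hcB w (Finset.mem_inter.1 hw).2) _).symm
        have h2 : H.colourDegree c' (T \ X) (c v) v ≤ H.colourDegree c0 (S \ X) (c v) v := by
          rw [colourDegree_congr (c := c') (c' := c0)]
          · exact colourDegree_mono (Finset.sdiff_subset_sdiff hT subset_rfl) _ _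
          · intro w hw hwv
            refine (hcY w fun hwB => ?_).symm
            exact (Finset.mem_sdiff.1 hw).2 ((Finset.mem_insert.1 hwB).resolve_left hwv)
        omega
      · rw [Function.update_of_ne hvz] at hlt
        exact ⟨v, hv.1, hcase T hT v ((Finset.mem_insert.1 hv.2).resolve_left hvz) hlt⟩
    · by_cases hX : (T ∩ X).Nonempty
      · have hTX : T ∩ X = T ∩ B := by
          rw [hB, Finset.inter_insert_of_notMem hz]
        rw [hTX] at hX
        obtain ⟨v, hv, hlt⟩ := hc (T ∩ B) Finset.inter_subset_right hX
        rw [Finset.mem_inter] at hv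
        have hvz : v ≠ z := fun hh => hz (hh ▸ hv.1)
        rw [Function.update_of_ne hvz] at hlt
        exact ⟨v, hv.1, hcase T hT v ((Finset.mem_insert.1 hv.2).resolve_left hvz) hlt⟩
      · rw [Finset.not_nonempty_iff_eq_empty] at hX
        refine (hc0.subset ?_).congr (T := T) (fun w hw => hcY w ?_) T subset_rfl hne
        · exact fun w hw => Finset.mem_erase.2 ⟨fun hh => hz (hh ▸ hw), hT hw⟩
        · intro hwB
          rcases Finset.mem_insert.1 hwB with rfl | hwX
          · exact hz hw
          · have : w ∈ T ∩ X := Finset.mem_inter.2 ⟨hw, hwX⟩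
            simp [hX] at this
  · intro v hv
    by_cases hvz : v = z
    · subst hvz
      rw [Function.update_self]
      have : H.edges.filter (fun e => v ∈ H.inc e ∧ H.inc e ⊆ B) ⊆
          Finset.univ.biUnion fun i => H.edges.filter fun e => v ∈ H.inc e ∧ H.inc e ⊆ B ∧
            ∀ w ∈ H.inc e, w ≠ v → c0 w = i := by
        intro e he
        simp only [Finset.mem_biUnion, Finset.mem_filter, Finset.mem_univ, true_and] at he ⊢
        obtain ⟨i, hi⟩ := hh.2 e he.1 he.2.1 (he.2.2.trans hBS)
        exact ⟨i, he.1, he.2.1, he.2.2, hi⟩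
      exact (Finset.card_le_card this).trans Finset.card_biUnion_le
    · rw [Function.update_of_ne hvz]
      refine le_trans (Finset.card_le_card fun e he => ?_) (hdeg v (hBS hv))
      simp only [Finset.mem_filter] at he ⊢
      exact ⟨he.1, he.2.1, he.2.2.trans hBS⟩
  · refine Finset.sum_lt_sum (fun i _ => by have := hxy i; omega) ?_
    -- The loss is strict because some edge at `z` goes to the other side.
    obtain ⟨e, he, heS, hze, y, hye, hy⟩ := h.compl.exists_edge hconn
    obtain ⟨i, hi⟩ := hh.2 e he hze heS
    refine ⟨i, Finset.mem_univ i, ?_⟩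
    have : 0 < H.colourDegree c0 (S \ X) i z := by
      refine Finset.card_pos.2 ⟨e, Finset.mem_filter.2 ⟨he, hze, ?_, hi⟩⟩
      intro w hw
      have := h.compl.closed e he heS ⟨y, hye, hy⟩ hw
      rw [Finset.mem_union, Finset.mem_singleton] at this
      refine Finset.mem_sdiff.2 ⟨heS hw, ?_⟩
      rcases this with this | rfl
      · exact (Finset.mem_sdiff.1 this).2
      · exact h.notMem
    have := hxy i
    omega

end Lobes

/-! ### Multigraphs without cut vertices and the deletion of a coloured vertex -/

section Uniform

open Classical

variable {α β ι : Type*}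

/-- Every edge inside `S` has exactly two vertices. -/
def Uniform (H : MultiHypergraph α β) (S : Finset α) : Prop :=
  ∀ e ∈ H.edges, H.inc e ⊆ S → (H.inc e).card = 2

/-- The capacities that remain when `u` is removed with colour `a`. -/
noncomputable def removeCap (H : MultiHypergraph α β) (f : α → ι → ℕ) (u : α) (a : ι) :
    α → ι → ℕ :=
  fun v i => f v i - if i = a then H.edgeMultiplicity u v else 0

/-- On `X`, only one colour has positive capacity. -/
def IsMono (f : α → ι → ℕ) (X : Finset α) : Prop :=
  ∃ j, ∀ v ∈ X, ∀ l, l ≠ j → f v l = 0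

/-- On `X`, the capacities do not depend on the vertex. -/
def IsConst (f : α → ι → ℕ) (X : Finset α) : Prop :=
  ∀ v ∈ X, ∀ w ∈ X, f v = f w

/-- A bad pair on a multigraph without cut vertices, with capacities at least the degrees. -/
structure BadPair [Fintype ι] (H : MultiHypergraph α β) (f : α → ι → ℕ) (S : Finset α) :
    Prop where
  uniform : H.Uniform S
  noCut : H.NoCut S
  bad : H.Bad f S
  deg : ∀ v ∈ S, H.degreeOn S v ≤ ∑ i, f v i

variable {H : MultiHypergraph α β} {f g : α → ι → ℕ} {c : α → ι} {S X B T : Finset α} {u v z : α}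

theorem IsMono.subset {Y : Finset α} (h : IsMono f Y) (hX : X ⊆ Y) : IsMono f X := by
  obtain ⟨j, hj⟩ := h
  exact ⟨j, fun v hv => hj v (hX hv)⟩

theorem IsConst.subset {Y : Finset α} (h : IsConst f Y) (hX : X ⊆ Y) : IsConst f X :=
  fun v hv w hw => h v (hX hv) w (hX hw)

theorem IsMono.congr (h : IsMono f X) (hfg : ∀ v ∈ X, f v = g v) : IsMono g X := by
  obtain ⟨j, hj⟩ := h
  exact ⟨j, fun v hv l hl => hfg v hv ▸ hj v hv l hl⟩

theorem IsConst.congr (h : IsConst f X) (hfg : ∀ v ∈ X, f v = g v) : IsConst g X :=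
  fun v hv w hw => by rw [← hfg v hv, ← hfg w hw, h v hv w hw]

theorem Uniform.subset (h : H.Uniform S) (hT : T ⊆ S) : H.Uniform T :=
  fun e he heT => h e he (heT.trans hT)

theorem edgeMultiplicity_comm (u v : α) : H.edgeMultiplicity u v = H.edgeMultiplicity v u := by
  simp only [edgeMultiplicity, Finset.pair_comm]

theorem Uniform.inc_eq (h : H.Uniform S) {e : β} (he : e ∈ H.edges) (heS : H.inc e ⊆ S)
    (hu : u ∈ H.inc e) (hv : v ∈ H.inc e) (huv : u ≠ v) : H.inc e = {u, v} := by
  refine (Finset.eq_of_subset_of_card_le (Finset.insert_subset hu (by simpa using hv)) ?_).symm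
  rw [h e he heS, Finset.card_pair huv]

theorem Uniform.edgeMultiplicity_ne_zero (h : H.Uniform S) {e : β} (he : e ∈ H.edges)
    (heS : H.inc e ⊆ S) (hu : u ∈ H.inc e) (hv : v ∈ H.inc e) (huv : u ≠ v) :
    H.edgeMultiplicity u v ≠ 0 :=
  Finset.card_ne_zero.2 ⟨e, Finset.mem_filter.2 ⟨he, h.inc_eq he heS hu hv huv⟩⟩

theorem exists_edge_of_edgeMultiplicity_ne_zero (h : H.edgeMultiplicity u v ≠ 0) :
    ∃ e ∈ H.edges, H.inc e = {u, v} := by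
  obtain ⟨e, he⟩ := Finset.card_ne_zero.1 h
  exact ⟨e, Finset.mem_filter.1 he⟩

theorem edgeMultiplicity_self : H.edgeMultiplicity v v = 0 := by
  by_contra h
  obtain ⟨e, he, h⟩ := exists_edge_of_edgeMultiplicity_ne_zero h
  have := H.two_le_card_inc e he
  simp [h] at this

theorem ne_of_edgeMultiplicity_ne_zero (h : H.edgeMultiplicity u v ≠ 0) : u ≠ v :=
  fun hh => h (hh ▸ edgeMultiplicity_self)

/-- In a multigraph, closedness can be tested on adjacent pairs. -/
theorem Uniform.closedOff {A W : Finset α} (h : H.Uniform S)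
    (hcl : ∀ w ∈ W, ∀ x ∈ S, H.edgeMultiplicity w x ≠ 0 → x ∉ A → x ∈ W) :
    H.ClosedOff S A W := by
  rintro e he heS ⟨w, hwe, hw⟩ x hx
  by_cases hxA : x ∈ A
  · exact Finset.mem_union_right _ hxA
  · refine Finset.mem_union_left _ ?_
    by_cases hwx : w = x
    · exact hwx ▸ hw
    · exact hcl w hw x (heS hx) (h.edgeMultiplicity_ne_zero he heS hwe hx hwx) hxA

theorem ClosedOff.mem {A W : Finset α} (h : H.ClosedOff S A W) {w x : α} (hw : w ∈ W)
    (hwS : w ∈ S) (hx : x ∈ S) (hm : H.edgeMultiplicity w x ≠ 0) (hxA : x ∉ A) : x ∈ W := by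
  obtain ⟨e, he, heq⟩ := exists_edge_of_edgeMultiplicity_ne_zero hm
  have := h e he (by rw [heq]; exact Finset.insert_subset hwS (by simpa using hx))
    ⟨w, by simp [heq], hw⟩ (show x ∈ H.inc e by simp [heq])
  exact (Finset.mem_union.1 this).resolve_right hxA

theorem degreeOn_singleton : H.degreeOn {v} v = 0 := by
  rw [degreeOn, Finset.card_eq_zero, Finset.filter_eq_empty_iff]
  rintro e he ⟨_, h⟩
  have := H.two_le_card_inc e he
  have := Finset.card_le_card h
  rw [Finset.card_singleton] at this
  omega

theorem Uniform.degreeOn_erase (h : H.Uniform S) (hu : u ∈ S) (hv : v ∈ S) (huv : u ≠ v) :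
    H.degreeOn S v = H.degreeOn (S.erase u) v + H.edgeMultiplicity u v := by
  unfold degreeOn edgeMultiplicity
  rw [← Finset.card_union_of_disjoint]
  · congr 1
    ext e
    simp only [Finset.mem_union, Finset.mem_filter]
    constructor
    · rintro ⟨he, hve, heS⟩
      by_cases hue : u ∈ H.inc e
      · exact Or.inr ⟨he, h.inc_eq he heS hue hve huv⟩
      · exact Or.inl ⟨he, hve, Finset.subset_erase.2 ⟨heS, hue⟩⟩
    · rintro (⟨he, hve, heS⟩ | ⟨he, heq⟩)
      · exact ⟨he, hve, heS.trans (Finset.erase_subset _ _)⟩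
      · refine ⟨he, by simp [heq], ?_⟩
        rw [heq]
        exact Finset.insert_subset hu (by simpa using hv)
  · rw [Finset.disjoint_left]
    intro e h1 h2
    simp only [Finset.mem_filter] at h1 h2
    have : u ∈ H.inc e := by simp [h2.2]
    exact Finset.notMem_erase u S (h1.2.2 this)

theorem Uniform.colourDegree_le_erase (h : H.Uniform T) (huv : u ≠ v) (i : ι) :
    H.colourDegree c T i v ≤
      H.colourDegree c (T.erase u) i v + if i = c u then H.edgeMultiplicity u v else 0 := by
  have hsub : (H.edges.filter fun e => v ∈ H.inc e ∧ H.inc e ⊆ T ∧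
      ∀ w ∈ H.inc e, w ≠ v → c w = i) ⊆
      (H.edges.filter fun e => v ∈ H.inc e ∧ H.inc e ⊆ T.erase u ∧
        ∀ w ∈ H.inc e, w ≠ v → c w = i) ∪
      (if i = c u then H.edges.filter fun e => H.inc e = {u, v} else ∅) := by
    intro e he
    simp only [Finset.mem_union, Finset.mem_filter] at he ⊢
    obtain ⟨he, hve, heT, hi⟩ := he
    by_cases hue : u ∈ H.inc e
    · right
      rw [if_pos (hi u hue huv).symm]
      exact Finset.mem_filter.2 ⟨he, h.inc_eq he heT hue hve huv⟩
    · exact Or.inl ⟨he, hve, Finset.subset_erase.2 ⟨heT, hue⟩, hi⟩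
  refine (Finset.card_le_card hsub).trans ((Finset.card_union_le _ _).trans ?_)
  refine Nat.add_le_add_left ?_ _
  split_ifs
  · rfl
  · simp

/-- This needs edges of size two: a larger edge through `u` links its other vertices in `ConnOff S
{u}` but is no longer present in `S.erase u`. -/
theorem Uniform.connOff_erase (h : H.Uniform S) (hconn : H.ConnOff S {u}) :
    H.ConnOff (S.erase u) ∅ := by
  intro W hW hne hcl
  rw [Finset.sdiff_empty] at hW ⊢
  rw [Finset.erase_eq] at hW ⊢
  refine hconn W hW hne (h.closedOff ?_)
  intro w hw x hx hm hxu
  refine hcl.mem hw ?_ ?_ hm (Finset.notMem_empty x)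
  · rw [Finset.erase_eq]; exact hW hw
  · rw [Finset.erase_eq]; exact Finset.mem_sdiff.2 ⟨hx, hxu⟩

/-- A good colouring for the reduced capacities extends by giving `u` colour `a`: every `v` gains at
most the multiplicity of `uv`, and `u` is peeled last, when its degree is `0 < f u a`. -/
theorem Bad.remove (hbad : H.Bad f S) (hU : H.Uniform S) (hu : u ∈ S) {a : ι} (ha : 1 ≤ f u a) :
    H.Bad (H.removeCap f u a) (S.erase u) := by
  intro c hc
  set c' := Function.update c u a with hc'
  have hcc : ∀ w, w ≠ u → c w = c' w := fun w hw => (Function.update_of_ne hw _ _).symm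
  have hc1 : H.Good (H.removeCap f u a) c' (S.erase u) :=
    hc.congr fun w hw => hcc w (Finset.ne_of_mem_erase hw)
  apply hbad c'
  intro T hT hne
  by_cases hsub : (T.erase u).Nonempty
  · obtain ⟨v, hv, hlt⟩ := hc1 (T.erase u) (Finset.erase_subset_erase _ hT) hsub
    refine ⟨v, Finset.mem_of_mem_erase hv, ?_⟩
    have h1 := (hU.subset hT).colourDegree_le_erase (c := c') (Finset.ne_of_mem_erase hv).symm (c' v)
    have h2 : c' u = a := Function.update_self _ _ _
    rw [h2] at h1
    simp only [removeCap] at hlt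
    omega
  · rw [Finset.not_nonempty_iff_eq_empty] at hsub
    have hTu : T ⊆ {u} := by
      intro x hx
      by_contra hxu
      have : x ∈ T.erase u := Finset.mem_erase.2 ⟨by simpa using hxu, hx⟩
      simp [hsub] at this
    obtain ⟨x, hx⟩ := hne
    obtain rfl : x = u := by simpa using hTu hx
    refine ⟨x, hx, ?_⟩
    have h0 : H.colourDegree c' T (c' x) x ≤ H.degreeOn {x} x := by
      refine Finset.card_le_card fun e he => ?_
      simp only [Finset.mem_filter] at he ⊢
      exact ⟨he.1, he.2.1, he.2.2.1.trans hTu⟩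
    rw [degreeOn_singleton] at h0
    have h2 : c' x = a := Function.update_self _ _ _
    rw [h2] at h0 ⊢
    omega

variable [Fintype ι]

theorem sum_removeCap {a : ι} (h : H.edgeMultiplicity u v ≤ f v a) :
    ∑ i, f v i = ∑ i, H.removeCap f u a v i + H.edgeMultiplicity u v := by
  have : ∀ i, f v i = H.removeCap f u a v i + if i = a then H.edgeMultiplicity u v else 0 := by
    intro i
    by_cases hi : i = a
    · subst hi
      simp only [removeCap, if_true]
      omega
    · simp [removeCap, hi]
  rw [Finset.sum_congr rfl fun i _ => this i, Finset.sum_add_distrib]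
  simp

namespace BadPair

/-- A colour available at `u` has capacity at least the multiplicity at every other vertex. -/
theorem edgeMultiplicity_le (h : H.BadPair f S) (hu : u ∈ S) (hv : v ∈ S) (huv : u ≠ v) {a : ι}
    (ha : 1 ≤ f u a) : H.edgeMultiplicity u v ≤ f v a := by
  obtain ⟨c, hc⟩ := h.bad.exists_hole h.noCut.1 h.deg ⟨a⟩ hu
  have hh := hc.hole' hu h.bad (h.deg u hu)
  rw [← hh.1 a, Nat.one_le_iff_ne_zero, colourDegree, Finset.card_ne_zero] at ha
  obtain ⟨e, he⟩ := ha
  simp only [Finset.mem_filter] at he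
  obtain ⟨he, hue, heS, hi⟩ := he
  obtain ⟨w, hwe, hwu⟩ := exists_ne_of_mem_edges he u
  -- Leaving `u` along an edge of colour `a` gives `u` that colour, which it keeps while the hole
  -- travels to `v`. There all `uv` edges count towards the colour degree `f v a`.
  have hc1 := hc.move' hu h.bad (h.deg u hu) he hue heS hwe hwu
  obtain ⟨c2, hc2, hcu⟩ := h.bad.exists_hole_keeping h.deg (h.noCut.2 u hu) (heS hwe) hwu hc1 hv
    huv.symm
  rw [Function.update_self, hi w hwe hwu] at hcu
  rw [← (hc2.hole' hv h.bad (h.deg v hv)).1 a]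
  refine Finset.card_le_card fun g hg => ?_
  simp only [Finset.mem_filter] at hg ⊢
  refine ⟨hg.1, by simp [hg.2], ?_, ?_⟩
  · rw [hg.2]
    exact Finset.insert_subset hu (by simpa using hv)
  · intro x hx hxv
    rw [hg.2, Finset.mem_insert, Finset.mem_singleton] at hx
    rw [hx.resolve_right hxv, hcu]

/-- By `edgeMultiplicity_le` availability of a colour passes to neighbours, hence by connectedness
to all vertices. -/
theorem pos_of_pos (h : H.BadPair f S) (hu : u ∈ S) (hv : v ∈ S) {a : ι} (ha : 1 ≤ f u a) :
    1 ≤ f v a := by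
  have := h.noCut.1 (S.filter fun w => 1 ≤ f w a) (by simp) ⟨u, by simp [hu, ha]⟩
    (h.uniform.closedOff (by
      intro w hw x hx hm _
      rw [Finset.mem_filter] at hw ⊢
      have := h.edgeMultiplicity_le hw.1 hx (ne_of_edgeMultiplicity_ne_zero hm) hw.2
      exact ⟨hx, by omega⟩))
  have hv' : v ∈ S.filter fun w => 1 ≤ f w a := by
    rw [this]
    simpa using hv
  exact (Finset.mem_filter.1 hv').2

theorem degreeOn_eq (h : H.BadPair f S) (hι : Nonempty ι) (hv : v ∈ S) :
    H.degreeOn S v = ∑ i, f v i :=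
  h.bad.degreeOn_eq h.noCut.1 h.deg hι hv

/-- Both total capacities equal the multiplicity of the pair, and a single available colour already
uses that much. -/
theorem isMono_pair (h : H.BadPair f {v, z}) (hvz : v ≠ z) (hι : Nonempty ι) :
    IsMono f {v, z} := by
  have hv : v ∈ ({v, z} : Finset α) := by simp
  have hz : z ∈ ({v, z} : Finset α) := by simp
  have d1 := h.uniform.degreeOn_erase hz hv hvz.symm
  have d2 := h.uniform.degreeOn_erase hv hz hvz
  rw [h.degreeOn_eq hι hv] at d1
  rw [h.degreeOn_eq hι hz] at d2
  have e1 : ({v, z} : Finset α).erase z = {v} := by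
    ext x; simp only [Finset.mem_erase, Finset.mem_insert, Finset.mem_singleton]
    constructor
    · tauto
    · rintro rfl; exact ⟨hvz, Or.inl rfl⟩
  have e2 : ({v, z} : Finset α).erase v = {z} := by
    ext x; simp only [Finset.mem_erase, Finset.mem_insert, Finset.mem_singleton]
    constructor
    · tauto
    · rintro rfl; exact ⟨hvz.symm, Or.inr rfl⟩
  rw [e1, degreeOn_singleton, zero_add] at d1
  rw [e2, degreeOn_singleton, zero_add] at d2
  rw [edgeMultiplicity_comm] at d1
  have key : ∀ a b, a ≠ b → f v a + f v b ≤ ∑ i, f v i ∧ f z a + f z b ≤ ∑ i, f z i := by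
    intro a b hab
    rw [← Finset.sum_pair hab, ← Finset.sum_pair (f := f z) hab]
    exact ⟨Finset.sum_le_sum_of_subset (Finset.subset_univ _),
      Finset.sum_le_sum_of_subset (Finset.subset_univ _)⟩
  by_cases hex : ∃ a, 1 ≤ f v a
  · obtain ⟨a, ha⟩ := hex
    have hza := h.pos_of_pos hv hz ha
    have h1 := h.edgeMultiplicity_le hv hz hvz ha
    have h2 := h.edgeMultiplicity_le hz hv hvz.symm hza
    rw [edgeMultiplicity_comm] at h2
    refine ⟨a, fun x hx l hl => ?_⟩
    have := key a l hl.symm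
    simp only [Finset.mem_insert, Finset.mem_singleton] at hx
    rcases hx with rfl | rfl <;> omega
  · push Not at hex
    have h0 : ∀ a, f v a = 0 := fun a => by have := hex a; omega
    refine ⟨hι.some, fun x hx l _ => ?_⟩
    simp only [Finset.mem_insert, Finset.mem_singleton] at hx
    rcases hx with rfl | rfl
    · exact h0 l
    · by_contra hne
      have := h.pos_of_pos hz hv (Nat.one_le_iff_ne_zero.2 hne)
      have := h0 l
      omega

/-- What the reduced capacities say about the neighbours of the removed vertex `u`. -/
theorem removed_const_or (h : H.BadPair f S) {a b : ι} (hab : a ≠ b) (hu : u ∈ S)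
    (ha : 1 ≤ f u a) (hb : 1 ≤ f u b) (hXS : X ⊆ S.erase u)
    (hdich : ∀ i, 1 ≤ f u i → IsMono (H.removeCap f u i) X ∨ IsConst (H.removeCap f u i) X) :
    (∀ v ∈ X, ∀ w ∈ X, f v = f w ∧ H.edgeMultiplicity u v = H.edgeMultiplicity u w) ∨
      ∀ i, 1 ≤ f u i → IsMono (H.removeCap f u i) X := by
  have hle : ∀ v ∈ X, ∀ i, 1 ≤ f u i → H.edgeMultiplicity u v ≤ f v i := fun v hv i hi =>
    h.edgeMultiplicity_le hu (Finset.mem_of_mem_erase (hXS hv))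
      (Finset.ne_of_mem_erase (hXS hv)).symm hi
  have hsame : ∀ i v, H.removeCap f u i v i = f v i - H.edgeMultiplicity u v := fun i v => by
    simp [removeCap]
  have hother : ∀ i v l, l ≠ i → H.removeCap f u i v l = f v l := fun i v l hl => by
    simp [removeCap, hl]
  by_cases hall : ∀ i, 1 ≤ f u i → IsMono (H.removeCap f u i) X
  · exact Or.inr hall
  left
  push Not at hall
  obtain ⟨l, hl, hlm⟩ := hall
  have hlc := (hdich l hl).resolve_left hlm
  have hne : ∀ v ∈ X, ∀ w ∈ X, ∀ x, x ≠ l → f v x = f w x := by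
    intro v hv w hw x hx
    rw [← hother l v x hx, ← hother l w x hx, hlc v hv w hw]
  have hll : ∀ v ∈ X, ∀ w ∈ X,
      f v l - H.edgeMultiplicity u v = f w l - H.edgeMultiplicity u w := by
    intro v hv w hw
    rw [← hsame, ← hsame, hlc v hv w hw]
  obtain ⟨i, hil, hi⟩ : ∃ i, i ≠ l ∧ 1 ≤ f u i := by
    by_cases hal : a = l
    · exact ⟨b, fun h' => hab (hal.trans h'.symm), hb⟩
    · exact ⟨a, hal, ha⟩
  intro v hv w hw
  have h1 := hll v hv w hw
  have h2 := hle v hv l hl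
  have h3 := hle w hw l hl
  -- Constancy for `l` leaves only colour `l` undecided. For a second available colour `i`, a
  -- monochromatic reduction keeps `l` alive, so `f x i` is exactly the multiplicity of `ux`; a
  -- constant one makes `f x l` constant directly.
  rcases hdich i hi with ⟨j, hj⟩ | hic
  · have hm : ∀ x ∈ X, f x i = H.edgeMultiplicity u x := by
      intro x hx
      have hxl := h.pos_of_pos hu (Finset.mem_of_mem_erase (hXS hx)) hl
      have hjl : l = j := by
        by_contra hne'
        have := hj x hx l hne'
        rw [hother i x l hil.symm] at this
        omega
      have := hj x hx i (hjl ▸ hil)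
      rw [hsame] at this
      have := hle x hx i hi
      omega
    have h4 := hne v hv w hw i hil
    rw [hm v hv, hm w hw] at h4
    refine ⟨funext fun x => ?_, h4⟩
    by_cases hx : x = l
    · subst hx; omega
    · exact hne v hv w hw x hx
  · have h4 : f v l = f w l := by
      rw [← hother i v l hil.symm, ← hother i w l hil.symm, hic v hv w hw]
    refine ⟨funext fun x => ?_, by omega⟩
    by_cases hx : x = l
    · subst hx; exact h4
    · exact hne v hv w hw x hx

/-- If all reduced capacities are supported on one colour, the multiplicities are determined. -/
theorem removed_mono (h : H.BadPair f S) {a b : ι} (hab : a ≠ b) (hu : u ∈ S)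
    (ha : 1 ≤ f u a) (hb : 1 ≤ f u b) (hXS : X ⊆ S.erase u)
    (hmono : ∀ i, 1 ≤ f u i → IsMono (H.removeCap f u i) X) {v : α} (hv : v ∈ X) :
    (∀ i, 1 ≤ f u i → f v i = H.edgeMultiplicity u v) ∧
      H.degreeOn S v = 2 * H.edgeMultiplicity u v := by
  have hvS := Finset.mem_of_mem_erase (hXS hv)
  have hvu := (Finset.ne_of_mem_erase (hXS hv)).symm
  -- Deleting `u` with colour `i` leaves `l` positive, so `l` is the only survivor and `i` is used
  -- up. Exchanging `a` and `b` shows that both equal the multiplicity, whence the factor `2`.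
  have key : ∀ i l, i ≠ l → 1 ≤ f u i → 1 ≤ f u l →
      f v i = H.edgeMultiplicity u v ∧ ∑ x, f v x = f v l + H.edgeMultiplicity u v := by
    intro i l hil hi hl
    obtain ⟨j, hj⟩ := hmono i hi
    have hle := h.edgeMultiplicity_le hu hvS hvu hi
    have hvl := h.pos_of_pos hu hvS hl
    have hother : H.removeCap f u i v l = f v l := by simp [removeCap, hil.symm]
    have hjl : l = j := by
      by_contra hne
      have := hj v hv l hne
      omega
    subst hjl
    have hi' := hj v hv i hil
    simp only [removeCap, if_true] at hi'
    refine ⟨by omega, ?_⟩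
    rw [sum_removeCap hle, Finset.sum_eq_single l (fun x _ hx => hj v hv x hx) (by simp), hother]
  have hA := key a b hab ha hb
  have hB := key b a hab.symm hb ha
  constructor
  · intro i hi
    by_cases hia : i = a
    · exact hia ▸ hA.1
    · exact (key i a hia hi ha).1
  · rw [h.degreeOn_eq ⟨a⟩ hvS]
    omega

/-- Degree and total capacity of `v` drop by the same amount: by `edgeMultiplicity_le` the
subtraction in `removeCap` is not truncated. -/
theorem remove_bad (h : H.BadPair f S) (hu : u ∈ S) {a : ι} (ha : 1 ≤ f u a) :
    H.ConnOff (S.erase u) ∅ ∧ H.Bad (H.removeCap f u a) (S.erase u) ∧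
      ∀ v ∈ S.erase u, H.degreeOn (S.erase u) v ≤ ∑ i, H.removeCap f u a v i := by
  refine ⟨h.uniform.connOff_erase (h.noCut.2 u hu), h.bad.remove h.uniform hu ha, ?_⟩
  intro v hv
  rw [Finset.mem_erase] at hv
  have h1 := h.uniform.degreeOn_erase hu hv.2 hv.1.symm
  have h2 := sum_removeCap (h.edgeMultiplicity_le hu hv.2 hv.1.symm ha)
  have h3 := h.deg v hv.2
  omega

theorem remove_noCut (h : H.BadPair f S) (hu : u ∈ S) {a : ι} (ha : 1 ≤ f u a)
    (hnc : H.NoCut (S.erase u)) : H.BadPair (H.removeCap f u a) (S.erase u) where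
  uniform := h.uniform.subset (Finset.erase_subset _ _)
  noCut := hnc
  bad := (h.remove_bad hu ha).2.1
  deg := (h.remove_bad hu ha).2.2

/-- When deleting `u` creates cut vertices, the induction uses an end block instead; its capacities
change only at its cut vertex. -/
theorem remove_leaf (h : H.BadPair f S) (hu : u ∈ S) {a : ι} (ha : 1 ≤ f u a)
    (hX : H.IsLeaf (S.erase u) X z) :
    ∃ g, H.BadPair g (insert z X) ∧ ∀ v ∈ X, g v = H.removeCap f u a v := by
  obtain ⟨h1, h2, h3⟩ := h.remove_bad hu ha
  obtain ⟨x, hx1, hx2, -, -⟩ := hX.1.exists_bad h2 h1 h3 ⟨a⟩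
  refine ⟨_, ⟨?_, hX.noCut h1, hx1, hx2⟩, fun v hv => ?_⟩
  · exact h.uniform.subset
      ((Finset.insert_subset hX.1.mem hX.1.subset').trans (Finset.erase_subset _ _))
  · exact Function.update_of_ne (ne_of_mem_of_not_mem hv hX.1.notMem) _ _

end BadPair

end Uniform

/-! ### The underlying graph: complete, or at most two neighbours everywhere -/

section Classification

open Classical

variable {α β ι : Type*} [Fintype ι]

/-- The inductive hypothesis of the classification of bad pairs: smaller bad pairs have either
monochromatic or constant capacities. -/
def SmallerClassified (ι : Type*) [Fintype ι] (H : MultiHypergraph α β) (S : Finset α) : Prop :=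
  ∀ (B : Finset α) (g : α → ι → ℕ), B.card < S.card → H.BadPair g B → IsMono g B ∨ IsConst g B

variable {H : MultiHypergraph α β} {f g : α → ι → ℕ} {S X : Finset α} {u v z : α} {a b : ι}

theorem exists_two_leaves (hconn : H.ConnOff S ∅) (h : ¬ H.NoCut S) :
    ∃ X z X' z', H.IsLeaf S X z ∧ H.IsLeaf S X' z' ∧ Disjoint X X' := by
  obtain ⟨X, z, hX⟩ := exists_lobe_of_not_noCut hconn h
  obtain ⟨Y, hY, y, hYl⟩ := hX.exists_leaf
  obtain ⟨Y', hY', y', hYl'⟩ := hX.compl.exists_leaf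
  exact ⟨Y, y, Y', y', hYl, hYl',
    Finset.disjoint_of_subset_left hY (Finset.disjoint_of_subset_right hY' Finset.disjoint_sdiff)⟩

theorem IsLobe.adj (h : H.IsLobe (S.erase u) X z) (hv : v ∈ X) {x : α} (hx : x ∈ S)
    (hm : H.edgeMultiplicity v x ≠ 0) : x = u ∨ x = z ∨ x ∈ X := by
  by_cases hxu : x = u
  · exact Or.inl hxu
  by_cases hxz : x = z
  · exact Or.inr (Or.inl hxz)
  · exact Or.inr (Or.inr (h.closed.mem hv (h.subset' hv) (Finset.mem_erase.2 ⟨hxu, hx⟩) hm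
      (by simpa using hxz)))

namespace BadPair

variable (h : H.BadPair f S) (hab : a ≠ b) (hpos : ∀ v ∈ S, 1 ≤ f v a ∧ 1 ≤ f v b)
  (IH : H.SmallerClassified ι S)

include h IH in
theorem removed_dich (hu : u ∈ S) (hnc : H.NoCut (S.erase u)) (i : ι) (hi : 1 ≤ f u i) :
    IsMono (H.removeCap f u i) (S.erase u) ∨ IsConst (H.removeCap f u i) (S.erase u) :=
  IH _ _ (Finset.card_erase_lt_of_mem hu) (h.remove_noCut hu hi hnc)

include h hab hpos

/-- Either the multiplicities to `u` are constant on `X`, hence all positive, or they equal the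
positive capacities in colour `a`. -/
theorem adj_of_removed (hu : u ∈ S) (hXS : X ⊆ S.erase u)
    (hdich : ∀ i, 1 ≤ f u i → IsMono (H.removeCap f u i) X ∨ IsConst (H.removeCap f u i) X)
    (hex : ∃ y ∈ X, H.edgeMultiplicity u y ≠ 0) (hv : v ∈ X) : H.edgeMultiplicity u v ≠ 0 := by
  rcases h.removed_const_or hab hu (hpos u hu).1 (hpos u hu).2 hXS hdich with hc | hm
  · obtain ⟨y, hy, hyu⟩ := hex
    rwa [(hc v hv y hy).2]
  · have h1 := (h.removed_mono hab hu (hpos u hu).1 (hpos u hu).2 hXS hm hv).1 a (hpos u hu).1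
    have h2 := (hpos v (Finset.mem_of_mem_erase (hXS hv))).1
    omega

include IH

theorem adj_of_noCut (hu : u ∈ S) (hnc : H.NoCut (S.erase u)) (hv : v ∈ S) (hvu : v ≠ u) :
    H.edgeMultiplicity u v ≠ 0 := by
  refine h.adj_of_removed hab hpos hu subset_rfl (h.removed_dich IH hu hnc) ?_
    (Finset.mem_erase.2 ⟨hvu, hv⟩)
  by_contra hcon
  push Not at hcon
  have := h.noCut.1 {u} (by simpa using hu) (Finset.singleton_nonempty u)
    (h.uniform.closedOff (by
      intro w hw x hx hm _
      rw [Finset.mem_singleton] at hw ⊢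
      subst hw
      by_contra hxw
      exact hm (hcon x (Finset.mem_erase.2 ⟨hxw, hx⟩))))
  have hv' : v ∈ ({u} : Finset α) := by
    rw [this]
    simpa using hv
  exact hvu (by simpa using hv')

/-- Some vertex of the leaf is adjacent to `u`, as otherwise `z` would separate `S`;
`adj_of_removed` extends this to the whole leaf. -/
theorem adj_of_leaf (hu : u ∈ S) (hX : H.IsLeaf (S.erase u) X z) (hv : v ∈ X) :
    H.edgeMultiplicity u v ≠ 0 := by
  have hXS := hX.1.subset'
  refine h.adj_of_removed hab hpos hu hXS ?_ ?_ hv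
  · intro i hi
    obtain ⟨g, hg, hgX⟩ := h.remove_leaf hu hi hX
    have hlt : (insert z X).card < S.card :=
      (Finset.card_le_card (Finset.insert_subset hX.1.mem hXS)).trans_lt
        (Finset.card_erase_lt_of_mem hu)
    exact (IH _ _ hlt hg).imp (fun hm => (hm.subset (Finset.subset_insert _ _)).congr hgX)
      (fun hm => (hm.subset (Finset.subset_insert _ _)).congr hgX)
  · by_contra hcon
    push Not at hcon
    have hzS := Finset.mem_of_mem_erase hX.1.mem
    have := h.noCut.2 z hzS X
      (hX.1.subset.trans (Finset.sdiff_subset_sdiff (Finset.erase_subset _ _) subset_rfl))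
      hX.1.nonempty (h.uniform.closedOff (by
        intro w hw x hx hm hxz
        rcases hX.1.adj hw hx hm with rfl | rfl | h'
        · rw [edgeMultiplicity_comm] at hm
          exact absurd (hcon w hw) hm
        · simp at hxz
        · exact h'))
    have hu' : u ∈ X := by
      rw [this, Finset.mem_sdiff]
      exact ⟨hu, by simpa using (Finset.ne_of_mem_erase hX.1.mem).symm⟩
    exact Finset.notMem_erase u S (hXS hu')

/-- A vertex that misses some other vertex leaves two disjoint leaves, both inside its
neighbourhood. -/
theorem two_leaves (hu : u ∈ S) {y : α} (hy : y ∈ S) (hyu : y ≠ u)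
    (hm : H.edgeMultiplicity u y = 0) :
    ∃ X z X' z', H.IsLeaf (S.erase u) X z ∧ H.IsLeaf (S.erase u) X' z' ∧ Disjoint X X' :=
  exists_two_leaves (h.remove_bad hu (hpos u hu).1).1
    fun hnc => h.adj_of_noCut hab hpos IH hu hnc hy hyu hm

/-- A fourth vertex is not adjacent to `v`, so `S - v` has two disjoint leaves. Both lie in the
neighbourhood of `v`, contained in `{p, q}`, so they are `{p}` and `{q}`. -/
theorem exists_leaf_singleton {p q : α} (hcard : 4 ≤ S.card) (hv : v ∈ S)
    (hN : ∀ x ∈ S, H.edgeMultiplicity v x ≠ 0 → x = p ∨ x = q) (hu : u ∈ S)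
    (hm : H.edgeMultiplicity v u ≠ 0) : ∃ z, H.IsLeaf (S.erase v) {u} z := by
  obtain ⟨y, hy⟩ : (S \ {v, p, q}).Nonempty := by
    rw [← Finset.card_pos]
    have := Finset.le_card_sdiff {v, p, q} S
    have := Finset.card_le_three (a := v) (b := p) (c := q)
    omega
  simp only [Finset.mem_sdiff, Finset.mem_insert, Finset.mem_singleton, not_or] at hy
  obtain ⟨X, z, X', z', hX, hX', hdisj⟩ := h.two_leaves hab hpos IH hv hy.1 hy.2.1 (by
    by_contra hne
    rcases hN y hy.1 hne with h' | h'
    · exact hy.2.2.1 h'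
    · exact hy.2.2.2 h')
  have sub : ∀ {Y y}, H.IsLeaf (S.erase v) Y y → ∀ x ∈ Y, x = p ∨ x = q := fun hY x hx =>
    hN x (Finset.mem_of_mem_erase (hY.1.subset' hx)) (h.adj_of_leaf hab hpos IH hv hY hx)
  obtain ⟨x, hx⟩ := hX.1.nonempty
  obtain ⟨x', hx'⟩ := hX'.1.nonempty
  have hxx : ∀ w ∈ X, ∀ w' ∈ X', w ≠ w' := fun w hw w' hw' heq =>
    Finset.disjoint_left.1 hdisj hw (heq ▸ hw')
  have h1 := hN u hu hm
  have s1 := sub hX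
  have s2 := sub hX'
  by_cases hux : u = x
  · refine ⟨z, ?_⟩
    have : X = {u} := by
      refine Finset.eq_singleton_iff_unique_mem.2 ⟨hux ▸ hx, fun w hw => ?_⟩
      have := hxx w hw x' hx'
      have := hxx x hx x' hx'
      rcases s1 w hw with rfl | rfl <;> rcases s2 x' hx' with rfl | rfl <;>
        rcases s1 x hx with rfl | rfl <;> simp_all
    exact this ▸ hX
  · refine ⟨z', ?_⟩
    have hux' : u = x' := by
      have := hxx x hx x' hx'
      rcases s1 x hx with rfl | rfl <;> rcases s2 x' hx' with rfl | rfl <;>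
        rcases h1 with rfl | rfl <;> simp_all
    have : X' = {u} := by
      refine Finset.eq_singleton_iff_unique_mem.2 ⟨hux' ▸ hx', fun w hw => ?_⟩
      have := hxx x hx w hw
      have := hxx x hx x' hx'
      rcases s2 w hw with rfl | rfl <;> rcases s2 x' hx' with rfl | rfl <;>
        rcases s1 x hx with rfl | rfl <;> simp_all
    exact this ▸ hX'

/-- If some vertex has at most two neighbours, so has every vertex. -/
theorem all_at_most_two (hcard : 4 ≤ S.card) (hv : v ∈ S)
    (hN : ∃ p q, ∀ x ∈ S, H.edgeMultiplicity v x ≠ 0 → x = p ∨ x = q) :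
    ∀ w ∈ S, ∃ p q, ∀ x ∈ S, H.edgeMultiplicity w x ≠ 0 → x = p ∨ x = q := by
  have := h.noCut.1
    (S.filter fun w => ∃ p q, ∀ x ∈ S, H.edgeMultiplicity w x ≠ 0 → x = p ∨ x = q) (by simp)
    ⟨v, by simpa [hv] using hN⟩ (h.uniform.closedOff (by
      intro w hw x hx hm _
      rw [Finset.mem_filter] at hw ⊢
      obtain ⟨hw, p, q, hpq⟩ := hw
      obtain ⟨z, hz⟩ := h.exists_leaf_singleton hab hpos IH hcard hw hpq hx hm
      refine ⟨hx, w, z, fun y hy hxy => ?_⟩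
      rcases hz.1.adj (Finset.mem_singleton_self x) hy hxy with h' | h' | h'
      · exact Or.inl h'
      · exact Or.inr h'
      · exact absurd (Finset.mem_singleton.1 h').symm (ne_of_edgeMultiplicity_ne_zero hxy)))
  intro w hw
  have hw' : w ∈ S.filter fun w => ∃ p q, ∀ x ∈ S, H.edgeMultiplicity w x ≠ 0 → x = p ∨ x = q := by
    rw [this]
    simpa using hw
  exact (Finset.mem_filter.1 hw').2

/-- A leaf that appears after the removal of a vertex is a single vertex. -/
theorem leaf_eq_singleton (hu : u ∈ S) (hX : H.IsLeaf (S.erase u) X z) (hv : v ∈ X) :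
    X = {v} := by
  by_contra hne
  have hvS := Finset.mem_of_mem_erase (hX.1.subset' hv)
  have hvu := Finset.ne_of_mem_erase (hX.1.subset' hv)
  have hvz : v ≠ z := ne_of_mem_of_not_mem hv hX.1.notMem
  have hconn := (h.remove_bad hu (hpos u hu).1).1
  have hsep := hX.connOff hconn hv
  obtain ⟨y, hy⟩ := hX.1.compl.nonempty
  simp only [Finset.mem_sdiff, Finset.mem_erase, Finset.mem_singleton] at hy
  obtain ⟨⟨⟨hyu, hyS⟩, hyz⟩, hyX⟩ := hy
  have hvy : H.edgeMultiplicity v y = 0 := by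
    by_contra hm
    rcases hX.1.adj hv hyS hm with h' | h' | h'
    · exact hyu h'
    · exact hyz h'
    · exact hyX h'
  have hyv : y ≠ v := fun h' => hyX (h' ▸ hv)
  obtain ⟨Y, t, Y', t', hY, hY', hdisj⟩ := h.two_leaves hab hpos IH hvS hyS hyv hvy
  obtain ⟨Y, t, hY, huY⟩ : ∃ Y t, H.IsLeaf (S.erase v) Y t ∧ u ∉ Y := by
    by_cases huY : u ∈ Y
    · exact ⟨Y', t', hY', Finset.disjoint_left.1 hdisj huY⟩
    · exact ⟨Y, t, hY, huY⟩
  have hYadj : ∀ w ∈ Y, H.edgeMultiplicity v w ≠ 0 := fun w hw =>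
    h.adj_of_leaf hab hpos IH hvS hY hw
  -- A common vertex of `X` and `Y` is adjacent to `u`, which forces `u = t`. Then `Y` is closed in
  -- `S - u - v`, so contains `y`, although `y` is not adjacent to `v`.
  have hYX : ∀ w ∈ Y, w ∉ X := by
    intro w hw hwX
    have hwu := h.adj_of_leaf hab hpos IH hu hX hwX
    rw [edgeMultiplicity_comm] at hwu
    have hut : u = t := by
      rcases hY.1.adj hw hu hwu with h' | h' | h'
      · exact absurd h'.symm hvu
      · exact h'
      · exact absurd h' huY
    have := hsep Y (fun x hx => by
        have := hY.1.subset' hx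
        simp only [Finset.mem_sdiff, Finset.mem_erase, Finset.mem_singleton] at this ⊢
        exact ⟨⟨fun hh => huY (hh ▸ hx), this.2⟩, this.1⟩) ⟨w, hw⟩
      ((h.uniform.subset (Finset.erase_subset _ _)).closedOff (by
        intro w' hw' x hx hm hxv
        rw [Finset.mem_erase] at hx
        rcases hY.1.adj hw' hx.2 hm with h' | h' | h'
        · exact absurd (by simpa using h') hxv
        · exact absurd (h'.trans hut.symm) hx.1
        · exact h'))
    have hyY : y ∈ Y := by
      rw [this]
      simp [hyu, hyS, hyv]
    exact hYadj y hyY hvy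
  -- All of `Y` is adjacent to `v`, whose neighbours lie in `X ∪ {u, z}`; hence `Y = {z}`, and `z`
  -- has no neighbours besides `v` and `t`.
  have hYz : ∀ w ∈ Y, w = z := by
    intro w hw
    rcases hX.1.adj hv (Finset.mem_of_mem_erase (hY.1.subset' hw)) (hYadj w hw) with h' | h' | h'
    · exact absurd (h' ▸ hw) huY
    · exact h'
    · exact absurd h' (hYX w hw)
  have hzY : z ∈ Y := by
    obtain ⟨w, hw⟩ := hY.1.nonempty
    exact hYz w hw ▸ hw
  have hNz : ∀ x ∈ S, H.edgeMultiplicity z x ≠ 0 → x = v ∨ x = t := by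
    intro x hx hm
    rcases hY.1.adj hzY hx hm with h' | h' | h'
    · exact Or.inl h'
    · exact Or.inr h'
    · exact absurd (hYz x h').symm (ne_of_edgeMultiplicity_ne_zero hm)
  have hzS := Finset.mem_of_mem_erase hX.1.mem
  obtain ⟨e, he, heS, hze, y', hye', hy'⟩ := hX.1.compl.exists_edge hconn
  have hyz' : z ≠ y' := fun hh => hX.1.compl.notMem (hh ▸ hy')
  have hm1 := (h.uniform.subset (Finset.erase_subset _ _)).edgeMultiplicity_ne_zero he heS hze hye'
    hyz'
  simp only [Finset.mem_sdiff, Finset.mem_erase, Finset.mem_singleton] at hy'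
  -- The neighbour of `z` beyond the leaf must be `t`, so `v` is the only possible neighbour of `z`
  -- in `X`, and `v` would separate `X - v` from `z` in `S - u`.
  have hyt : y' = t := (hNz y' hy'.1.1.2 hm1).resolve_left fun hh => hy'.2 (hh ▸ hv)
  have hXt : t ∉ X := hyt ▸ hy'.2
  have hXz : ∀ w ∈ X, w ≠ v → H.edgeMultiplicity w z = 0 := by
    intro w hw hwv
    by_contra hm
    rw [edgeMultiplicity_comm] at hm
    rcases hNz w (Finset.mem_of_mem_erase (hX.1.subset' hw)) hm with h' | h'
    · exact hwv h'
    · exact hXt (h' ▸ hw)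
  have := hsep (X.erase v) (by
      rw [Finset.erase_eq]
      exact Finset.sdiff_subset_sdiff hX.1.subset' subset_rfl) (by
      rw [Finset.nonempty_iff_ne_empty]
      intro h0
      rw [Finset.erase_eq_empty_iff] at h0
      rcases h0 with h0 | h0
      · exact absurd (h0 ▸ hv) (Finset.notMem_empty v)
      · exact hne h0) ((h.uniform.subset (Finset.erase_subset _ _)).closedOff (by
      intro w hw x hx hm hxv
      rw [Finset.mem_erase] at hw hx ⊢
      rcases hX.1.adj hw.2 hx.2 hm with h' | h' | h'
      · exact absurd h' hx.1
      · rw [h'] at hm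
        exact absurd (hXz w hw.2 hw.1) hm
      · exact ⟨by simpa using hxv, h'⟩))
  have hzX : z ∈ X.erase v := by
    rw [this, Finset.mem_sdiff]
    exact ⟨hX.1.mem, by simpa using hvz.symm⟩
  exact hX.1.notMem (Finset.mem_of_mem_erase hzX)

/-- Either all vertices are pairwise adjacent, or every vertex has at most two neighbours. -/
theorem complete_or_two :
    (∀ u ∈ S, ∀ v ∈ S, u ≠ v → H.edgeMultiplicity u v ≠ 0) ∨
      (4 ≤ S.card ∧
        ∀ w ∈ S, ∃ p q, ∀ x ∈ S, H.edgeMultiplicity w x ≠ 0 → x = p ∨ x = q) := by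
  by_cases hc : ∀ u ∈ S, ∀ v ∈ S, u ≠ v → H.edgeMultiplicity u v ≠ 0
  · exact Or.inl hc
  right
  push Not at hc
  obtain ⟨u, hu, y, hy, hyu, hm⟩ := hc
  obtain ⟨X, z, X', z', hX, hX', hdisj⟩ := h.two_leaves hab hpos IH hu hy hyu.symm hm
  obtain ⟨v, hv⟩ := hX.1.nonempty
  have hXv := h.leaf_eq_singleton hab hpos IH hu hX hv
  obtain ⟨w, hw⟩ := hX.1.compl.nonempty
  simp only [Finset.mem_sdiff, Finset.mem_erase, Finset.mem_singleton] at hw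
  have hzS := hX.1.mem
  have hvS := hX.1.subset' hv
  rw [Finset.mem_erase] at hzS hvS
  have hvz : v ≠ z := ne_of_mem_of_not_mem hv hX.1.notMem
  have hvw : v ≠ w := ne_of_mem_of_not_mem hv hw.2
  have hcard : 4 ≤ S.card := by
    have hsub : ({u, z, v, w} : Finset α) ⊆ S := by
      intro x hx
      simp only [Finset.mem_insert, Finset.mem_singleton] at hx
      rcases hx with rfl | rfl | rfl | rfl
      · exact hu
      · exact hzS.2
      · exact hvS.2
      · exact hw.1.1.2
    have := Finset.card_le_card hsub
    rwa [Finset.card_insert_of_notMem, Finset.card_insert_of_notMem,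
      Finset.card_pair hvw] at this
    · simp only [Finset.mem_insert, Finset.mem_singleton, not_or]
      exact ⟨hvz.symm, fun hh => hw.1.2 hh.symm⟩
    · simp only [Finset.mem_insert, Finset.mem_singleton, not_or]
      exact ⟨fun hh => hzS.1 hh.symm, fun hh => hvS.1 hh.symm, fun hh => hw.1.1.1 hh.symm⟩
  -- The only vertex of a singleton leaf sees at most the deleted vertex `u` and the cut vertex `z`.
  refine ⟨hcard, h.all_at_most_two hab hpos IH hcard hvS.2 ⟨u, z, fun x hx hm => ?_⟩⟩
  rcases hX.1.adj hv hx hm with h' | h' | h'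
  · exact Or.inl h'
  · exact Or.inr h'
  · rw [hXv, Finset.mem_singleton] at h'
    exact absurd h'.symm (ne_of_edgeMultiplicity_ne_zero hm)

end BadPair

end Classification

/-! ### Constancy of capacities and multiplicities -/

section ConstantCapacities

open Classical

variable {α β ι : Type*} {H : MultiHypergraph α β} {f g : α → ι → ℕ} {S T X : Finset α} {u v z : α} {a b : ι}

theorem noCut_of_complete
    (hc : ∀ u ∈ T, ∀ v ∈ T, u ≠ v → H.edgeMultiplicity u v ≠ 0) : H.NoCut T := by
  have key : ∀ A, H.ConnOff T A := by
    rintro A W hW ⟨w, hw⟩ hcl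
    refine Finset.Subset.antisymm hW fun x hx => ?_
    by_cases hwx : w = x
    · exact hwx ▸ hw
    · rw [Finset.mem_sdiff] at hx
      have hwT := (Finset.mem_sdiff.1 (hW hw)).1
      exact hcl.mem hw hwT hx.1 (hc w hwT x hx.1 hwx) hx.2
  exact ⟨key ∅, fun v _ => key {v}⟩

variable [Fintype ι]

namespace BadPair

theorem nonempty (h : H.BadPair f S) (a : ι) : S.Nonempty := by
  rw [Finset.nonempty_iff_ne_empty]
  rintro rfl
  exact h.bad (fun _ => a) good_empty

theorem exists_pos_of_not_isMono (h : H.BadPair f S) (hι : Nonempty ι) (hm : ¬ IsMono f S) :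
    ∃ a b, a ≠ b ∧ ∀ v ∈ S, 1 ≤ f v a ∧ 1 ≤ f v b := by
  obtain ⟨a, v, hv, ha⟩ : ∃ a, ∃ v ∈ S, 1 ≤ f v a := by
    by_contra hcon
    push Not at hcon
    exact hm ⟨hι.some, fun v hv l _ => Nat.lt_one_iff.1 (hcon l v hv)⟩
  obtain ⟨b, hb, w, hw, hwb⟩ : ∃ b, b ≠ a ∧ ∃ w ∈ S, 1 ≤ f w b := by
    by_contra hcon
    push Not at hcon
    exact hm ⟨a, fun v hv l hl => Nat.lt_one_iff.1 (hcon l hl v hv)⟩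
  exact ⟨a, b, hb.symm, fun x hx => ⟨h.pos_of_pos hv hx ha, h.pos_of_pos hw hx hwb⟩⟩

section

variable (h : H.BadPair f S) (hab : a ≠ b) (hpos : ∀ v ∈ S, 1 ≤ f v a ∧ 1 ≤ f v b)
  (IH : H.SmallerClassified ι S)

include h hab hpos

theorem three_le_card : 3 ≤ S.card := by
  by_contra hcard
  have h0 := Finset.card_pos.2 (h.nonempty a)
  have h12 : S.card = 1 ∨ S.card = 2 := by omega
  rcases h12 with h1 | h2
  · obtain ⟨v, rfl⟩ := Finset.card_eq_one.1 h1
    have hv := Finset.mem_singleton_self v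
    have h3 := h.degreeOn_eq ⟨a⟩ hv
    rw [degreeOn_singleton] at h3
    have := Finset.single_le_sum (f := f v) (fun i _ => Nat.zero_le _) (Finset.mem_univ a)
    have := (hpos v hv).1
    omega
  · obtain ⟨v, w, hvw, rfl⟩ := Finset.card_eq_two.1 h2
    obtain ⟨j, hj⟩ := h.isMono_pair hvw ⟨a⟩
    have hv : v ∈ ({v, w} : Finset α) := by simp
    have hp := hpos v hv
    by_cases haj : a = j
    · have := hj v hv b (fun h' => hab (haj.trans h'.symm))
      omega
    · have := hj v hv a haj
      omega

/-- Two vertices of a complete bad pair whose removal leaves monochromatic capacities. -/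
theorem const_of_two_mono (hc : ∀ u ∈ S, ∀ v ∈ S, u ≠ v → H.edgeMultiplicity u v ≠ 0)
    (hu : u ∈ S) (hv : v ∈ S) (huv : u ≠ v)
    (hMu : ∀ i, 1 ≤ f u i → IsMono (H.removeCap f u i) (S.erase u))
    (hMv : ∀ i, 1 ≤ f v i → IsMono (H.removeCap f v i) (S.erase v)) :
    IsConst f S ∧ ∃ t, ∀ x ∈ S, ∀ y ∈ S, x ≠ y → H.edgeMultiplicity x y = t := by
  have Mu : ∀ w ∈ S, w ≠ u → _ := fun w hw hwu => h.removed_mono hab hu (hpos u hu).1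
    (hpos u hu).2 subset_rfl hMu (Finset.mem_erase.2 ⟨hwu, hw⟩)
  have Mv : ∀ w ∈ S, w ≠ v → _ := fun w hw hwv => h.removed_mono hab hv (hpos v hv).1
    (hpos v hv).2 subset_rfl hMv (Finset.mem_erase.2 ⟨hwv, hw⟩)
  obtain ⟨w, hw⟩ : (S \ {u, v}).Nonempty := by
    rw [← Finset.card_pos]
    have := Finset.le_card_sdiff {u, v} S
    have := Finset.card_le_two (a := u) (b := v)
    have := h.three_le_card hab hpos
    omega
  simp only [Finset.mem_sdiff, Finset.mem_insert, Finset.mem_singleton, not_or] at hw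
  obtain ⟨hwS, hwu, hwv⟩ := hw
  have hU := h.uniform
  have hUu := hU.subset (Finset.erase_subset u S)
  have hUuv := hUu.subset (Finset.erase_subset v _)
  have e1 := (Mu w hwS hwu).1 a (hpos u hu).1
  have e2 := (Mv w hwS hwv).1 a (hpos v hv).1
  have e3 := (Mu w hwS hwu).2
  have e4 := hU.degreeOn_erase hu hwS (Ne.symm hwu)
  have e5 := hUu.degreeOn_erase (Finset.mem_erase.2 ⟨huv.symm, hv⟩)
    (Finset.mem_erase.2 ⟨hwu, hwS⟩) (Ne.symm hwv)
  -- The degree of `w` is twice the multiplicity of `uw`, which equals that of `vw`; the edges to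
  -- `u` and `v` exhaust it, leaving none for a fourth vertex.
  have hall : ∀ y ∈ S, y = u ∨ y = v ∨ y = w := by
    intro y hy
    by_contra hcon
    push Not at hcon
    have e6 := hUuv.degreeOn_erase
      (Finset.mem_erase.2 ⟨hcon.2.1, Finset.mem_erase.2 ⟨hcon.1, hy⟩⟩)
      (Finset.mem_erase.2 ⟨hwv, Finset.mem_erase.2 ⟨hwu, hwS⟩⟩) hcon.2.2
    have := hc y hy w hwS hcon.2.2
    omega
  have d1 := (Mu v hv huv.symm).2
  have d2 := hU.degreeOn_erase hu hv huv
  have d3 := hUu.degreeOn_erase (Finset.mem_erase.2 ⟨hwu, hwS⟩)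
    (Finset.mem_erase.2 ⟨huv.symm, hv⟩) hwv
  have hsing : (S.erase u).erase w = {v} := by
    ext x
    simp only [Finset.mem_erase, Finset.mem_singleton]
    constructor
    · rintro ⟨h1, h2, h3⟩
      rcases hall x h3 with h' | h' | h' <;> tauto
    · rintro rfl
      exact ⟨Ne.symm hwv, huv.symm, hv⟩
  rw [hsing, degreeOn_singleton] at d3
  have t1 : H.edgeMultiplicity w v = H.edgeMultiplicity u v := by omega
  have t2 : H.edgeMultiplicity u w = H.edgeMultiplicity u v := by
    rw [← e1, e2, edgeMultiplicity_comm v w, t1]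
  have fu : ∀ i, 1 ≤ f u i → f u i = H.edgeMultiplicity u v := fun i hi => by
    rw [(Mv u hu huv).1 i (h.pos_of_pos hu hv hi), edgeMultiplicity_comm]
  have fall : ∀ x ∈ S, f x = f u := by
    intro x hx
    funext i
    by_cases hi : 1 ≤ f u i
    · rw [fu i hi]
      rcases hall x hx with rfl | rfl | rfl
      · exact fu i hi
      · exact (Mu x hx huv.symm).1 i hi
      · rw [(Mu x hx hwu).1 i hi, t2]
    · have : ¬ 1 ≤ f x i := fun h' => hi (h.pos_of_pos hx hu h')
      omega
  refine ⟨fun x hx y hy => (fall x hx).trans (fall y hy).symm, H.edgeMultiplicity u v, ?_⟩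
  intro x hx y hy hxy
  rcases hall x hx with rfl | rfl | rfl <;> rcases hall y hy with rfl | rfl | rfl <;>
    first
    | exact absurd rfl hxy
    | rfl
    | exact t1
    | exact t2
    | exact edgeMultiplicity_comm _ _
    | (rw [edgeMultiplicity_comm]; exact t1)
    | (rw [edgeMultiplicity_comm]; exact t2)

include IH

/-- Deleting any vertex leaves a complete graph, so the dichotomy of `removed_const_or` holds at
every vertex. Two vertices of monochromatic type are settled by `const_of_two_mono`; otherwise all
vertices but at most one are of constant type, and values are compared by deleting a third vertex.
-/
theorem const_of_complete (hc : ∀ u ∈ S, ∀ v ∈ S, u ≠ v → H.edgeMultiplicity u v ≠ 0) :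
    IsConst f S ∧ ∃ t, ∀ x ∈ S, ∀ y ∈ S, x ≠ y → H.edgeMultiplicity x y = t := by
  have hnc : ∀ u, H.NoCut (S.erase u) := fun u => noCut_of_complete fun x hx y hy =>
    hc x (Finset.mem_of_mem_erase hx) y (Finset.mem_of_mem_erase hy)
  have alt : ∀ u ∈ S, _ := fun u hu => h.removed_const_or hab hu (hpos u hu).1 (hpos u hu).2
    subset_rfl (h.removed_dich IH hu (hnc u))
  have h3 := h.three_le_card hab hpos
  have hthird : ∀ x y, ∃ w ∈ S, w ≠ x ∧ w ≠ y := by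
    intro x y
    obtain ⟨w, hw⟩ : (S \ {x, y}).Nonempty := by
      rw [← Finset.card_pos]
      have := Finset.le_card_sdiff {x, y} S
      have := Finset.card_le_two (a := x) (b := y)
      omega
    simp only [Finset.mem_sdiff, Finset.mem_insert, Finset.mem_singleton, not_or] at hw
    exact ⟨w, hw.1, hw.2⟩
  by_cases hex : ∃ u ∈ S, ∃ v ∈ S, u ≠ v ∧
      (∀ i, 1 ≤ f u i → IsMono (H.removeCap f u i) (S.erase u)) ∧
      ∀ i, 1 ≤ f v i → IsMono (H.removeCap f v i) (S.erase v)
  · obtain ⟨u, hu, v, hv, huv, hMu, hMv⟩ := hex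
    exact h.const_of_two_mono hab hpos hc hu hv huv hMu hMv
  obtain ⟨u0, hu0, hA⟩ : ∃ u0 ∈ S, ∀ x ∈ S, x ≠ u0 → ∀ v ∈ S.erase x, ∀ w ∈ S.erase x,
      f v = f w ∧ H.edgeMultiplicity x v = H.edgeMultiplicity x w := by
    by_cases hM : ∃ u ∈ S, ∀ i, 1 ≤ f u i → IsMono (H.removeCap f u i) (S.erase u)
    · obtain ⟨u0, hu0, hM0⟩ := hM
      refine ⟨u0, hu0, fun x hx hxu => (alt x hx).resolve_right fun hMx => ?_⟩
      exact hex ⟨x, hx, u0, hu0, hxu, hMx, hM0⟩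
    · obtain ⟨u0, hu0⟩ := h.nonempty a
      exact ⟨u0, hu0, fun x hx _ => (alt x hx).resolve_right fun hMx => hM ⟨x, hx, hMx⟩⟩
  have hf : ∀ x ∈ S, f x = f u0 := by
    intro x hx
    obtain ⟨w, hw, hwx, hwu⟩ := hthird x u0
    exact (hA w hw hwu x (Finset.mem_erase.2 ⟨hwx.symm, hx⟩) u0
      (Finset.mem_erase.2 ⟨hwu.symm, hu0⟩)).1
  have hxy : ∀ x ∈ S, x ≠ u0 → ∀ y ∈ S, y ≠ x →
      H.edgeMultiplicity x y = H.edgeMultiplicity x u0 := by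
    intro x hx hxu y hy hyx
    exact (hA x hx hxu y (Finset.mem_erase.2 ⟨hyx, hy⟩) u0
      (Finset.mem_erase.2 ⟨hxu.symm, hu0⟩)).2
  obtain ⟨x0, hx0, hx0u, -⟩ := hthird u0 u0
  have ht : ∀ x ∈ S, x ≠ u0 → H.edgeMultiplicity x u0 = H.edgeMultiplicity x0 u0 := by
    intro x hx hxu
    by_cases hxx : x = x0
    · rw [hxx]
    · rw [← hxy x hx hxu x0 hx0 (Ne.symm hxx), edgeMultiplicity_comm,
        hxy x0 hx0 hx0u x hx hxx]
  refine ⟨fun x hx y hy => (hf x hx).trans (hf y hy).symm, H.edgeMultiplicity x0 u0, ?_⟩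
  intro x hx y hy hne
  by_cases hxu : x = u0
  · subst hxu
    rw [edgeMultiplicity_comm]
    exact ht y hy hne.symm
  · rw [hxy x hx hxu y hy hne.symm]
    exact ht x hx hxu

/-- Each neighbour `v` of `u` is a singleton leaf of `S - u`, whose two-vertex block is
monochromatic by `isMono_pair`. Hence available capacities at `v` equal the multiplicity of `uv`; by
symmetry so do those at `u`, and connectedness spreads the common value. -/
theorem const_of_two (hcard : 4 ≤ S.card)
    (hN : ∀ w ∈ S, ∃ p q, ∀ x ∈ S, H.edgeMultiplicity w x ≠ 0 → x = p ∨ x = q) :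
    IsConst f S ∧
      ∃ t, ∀ x ∈ S, ∀ y ∈ S, H.edgeMultiplicity x y ≠ 0 → H.edgeMultiplicity x y = t := by
  have key : ∀ u ∈ S, ∀ v ∈ S, H.edgeMultiplicity u v ≠ 0 →
      ∀ i, 1 ≤ f u i → f v i = H.edgeMultiplicity u v := by
    intro u hu v hv hm i hi
    obtain ⟨p, q, hpq⟩ := hN u hu
    obtain ⟨z, hz⟩ := h.exists_leaf_singleton hab hpos IH hcard hu hpq hv hm
    refine (h.removed_mono hab hu (hpos u hu).1 (hpos u hu).2 (X := {v}) hz.1.subset' ?_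
      (Finset.mem_singleton_self v)).1 i hi
    intro j hj
    obtain ⟨g, hg, hgv⟩ := h.remove_leaf hu hj hz
    have hzv : z ≠ v := fun hh => hz.1.notMem (by simp [hh])
    exact ((hg.isMono_pair hzv ⟨a⟩).subset (Finset.subset_insert _ _)).congr hgv
  have hadj : ∀ u ∈ S, ∀ v ∈ S, H.edgeMultiplicity u v ≠ 0 → f u = f v := by
    intro u hu v hv hm
    funext i
    by_cases hi : 1 ≤ f u i
    · rw [key u hu v hv hm i hi]
      rw [edgeMultiplicity_comm] at hm ⊢
      exact key v hv u hu hm i (h.pos_of_pos hu hv hi)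
    · have : ¬ 1 ≤ f v i := fun h' => hi (h.pos_of_pos hv hu h')
      omega
  obtain ⟨v0, hv0⟩ := h.nonempty a
  have hall : ∀ x ∈ S, f x = f v0 := by
    have := h.noCut.1 (S.filter fun x => f x = f v0) (by simp) ⟨v0, by simp [hv0]⟩
      (h.uniform.closedOff (by
        intro w hw x hx hm _
        rw [Finset.mem_filter] at hw ⊢
        exact ⟨hx, (hadj w hw.1 x hx hm).symm.trans hw.2⟩))
    intro x hx
    have hx' : x ∈ S.filter fun x => f x = f v0 := by
      rw [this]
      simpa using hx
    exact (Finset.mem_filter.1 hx').2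
  refine ⟨fun x hx y hy => (hall x hx).trans (hall y hy).symm, f v0 a, fun x hx y hy hm => ?_⟩
  rw [← hall y hy]
  exact (key x hx y hy hm a (hpos x hx).1).symm

end

/-- The capacities of a bad pair are monochromatic or constant. -/
theorem isMono_or_isConst (h : H.BadPair f S) (hι : Nonempty ι) : IsMono f S ∨ IsConst f S := by
  induction hn : S.card using Nat.strong_induction_on generalizing S f with
  | _ n ih =>
    have IH : H.SmallerClassified ι S := fun B g hlt hB => ih B.card (hn ▸ hlt) hB rfl
    by_cases hm : IsMono f S
    · exact Or.inl hm
    obtain ⟨a, b, hab, hpos⟩ := h.exists_pos_of_not_isMono hι hm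
    rcases h.complete_or_two hab hpos IH with hc | ⟨h4, hN⟩
    · exact Or.inr (h.const_of_complete hab hpos IH hc).1
    · exact Or.inr (h.const_of_two hab hpos IH h4 hN).1

/-- A bad pair with two available colours is a multiple of a complete graph or of a graph all of
whose vertices have at most two neighbours. -/
theorem multiplicity_classification (h : H.BadPair f S) (hab : a ≠ b)
    (hpos : ∀ v ∈ S, 1 ≤ f v a ∧ 1 ≤ f v b) :
    ∃ t, 1 ≤ t ∧ ((∀ x ∈ S, ∀ y ∈ S, x ≠ y → H.edgeMultiplicity x y = t) ∨
      (4 ≤ S.card ∧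
        (∀ w ∈ S, ∃ p q, ∀ x ∈ S, H.edgeMultiplicity w x ≠ 0 → x = p ∨ x = q) ∧
        ∀ x ∈ S, ∀ y ∈ S, H.edgeMultiplicity x y ≠ 0 → H.edgeMultiplicity x y = t)) := by
  have IH : H.SmallerClassified ι S := fun B g _ hB => hB.isMono_or_isConst ⟨a⟩
  rcases h.complete_or_two hab hpos IH with hc | ⟨h4, hN⟩
  · obtain ⟨-, t, ht⟩ := h.const_of_complete hab hpos IH hc
    refine ⟨t, ?_, Or.inl ht⟩
    have h3 := h.three_le_card hab hpos
    obtain ⟨x, hx, y, hy, hxy⟩ := Finset.one_lt_card.1 (by omega : 1 < S.card)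
    rw [← ht x hx y hy hxy]
    exact Nat.one_le_iff_ne_zero.2 (hc x hx y hy hxy)
  · obtain ⟨-, t, ht⟩ := h.const_of_two hab hpos IH h4 hN
    -- With `t = 0` no multiplicity is non-zero and the condition is vacuous, so `1` serves as the
    -- positive value.
    by_cases h0 : t = 0
    · refine ⟨1, le_rfl, Or.inr ⟨h4, hN, fun x hx y hy hm => ?_⟩⟩
      exact absurd (h0 ▸ ht x hx y hy hm) hm
    · exact ⟨t, Nat.one_le_iff_ne_zero.2 h0, Or.inr ⟨h4, hN, ht⟩⟩

end BadPair

end ConstantCapacities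

end MultiHypergraph

/-! ### Two-regular connected graphs and parity on even cycles -/

section CycleGraph

variable {V : Type*}

theorem SimpleGraph.ncard_neighborSet_cycleGraph {n : ℕ} (hn : 3 ≤ n) (i : Fin n) :
    ((SimpleGraph.cycleGraph n).neighborSet i).ncard = 2 := by
  obtain ⟨m, rfl⟩ : ∃ m, n = m + 3 := ⟨n - 3, by omega⟩
  rw [← SimpleGraph.coe_neighborFinset, Set.ncard_coe_finset]
  exact SimpleGraph.cycleGraph_degree_three_le

/-- A connected graph in which every vertex has exactly two neighbours is a cycle. -/
theorem SimpleGraph.Connected.exists_equiv_cycleGraph [Finite V] {G : SimpleGraph V}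
    (hconn : G.Connected) (hdeg : ∀ v, (G.neighborSet v).ncard = 2) :
    ∃ n, 3 ≤ n ∧ ∃ φ : Fin n ≃ V, ∀ i j, G.Adj (φ i) (φ j) ↔ (SimpleGraph.cycleGraph n).Adj i j := by
  obtain ⟨v⟩ := hconn.nonempty
  have hcyc : G.IsCycles := fun w _ => hdeg w
  have hne : (G.neighborSet v).Nonempty := by
    rw [← Set.ncard_pos (Set.toFinite _), hdeg v]
    exact two_pos
  obtain ⟨p, hp, hverts⟩ := hcyc.exists_cycle_toSubgraph_verts_eq_connectedComponentSupp
    (SimpleGraph.ConnectedComponent.connectedComponentMk_mem (G := G) (v := v)) hne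
  have h3 := hp.three_le_length
  have hinj : Function.Injective fun i : Fin p.length => p.getVert i := by
    intro i j hij
    exact Fin.ext (hp.getVert_injOn' (by simp only [Set.mem_ofPred_eq]; omega)
      (by simp only [Set.mem_ofPred_eq]; omega) hij)
  have hsurj : Function.Surjective fun i : Fin p.length => p.getVert i := by
    intro w
    have hw : w ∈ p.toSubgraph.verts := by
      rw [hverts, SimpleGraph.ConnectedComponent.mem_supp_iff, SimpleGraph.ConnectedComponent.eq]
      exact hconn.preconnected w v
    rw [SimpleGraph.Walk.mem_verts_toSubgraph,
      SimpleGraph.Walk.mem_support_iff_exists_getVert] at hw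
    obtain ⟨m, hm, hmp⟩ := hw
    -- The closed walk repeats its start at the end, so the last index is replaced by `0`.
    by_cases hml : m = p.length
    · refine ⟨⟨0, by omega⟩, ?_⟩
      change p.getVert 0 = w
      rw [SimpleGraph.Walk.getVert_zero, ← hm, hml, SimpleGraph.Walk.getVert_length]
    · exact ⟨⟨m, by omega⟩, hm⟩
  set φ := Equiv.ofBijective _ ⟨hinj, hsurj⟩ with hφ
  have hφv : ∀ i, φ i = p.getVert i := fun _ => rfl
  have hone : ∀ i j : Fin p.length, (j - i).val = 1 → G.Adj (φ i) (φ j) := by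
    intro i j hij
    rw [hφv, hφv]
    have hi := i.isLt
    have hj := j.isLt
    have hadj := p.adj_getVert_succ hi
    have hcase : (j : ℕ) = i + 1 ∨ ((i : ℕ) + 1 = p.length ∧ (j : ℕ) = 0) := by
      rw [Fin.sub_def] at hij
      simp only at hij
      by_cases hle : (i : ℕ) ≤ j
      · have : p.length - (i : ℕ) + j = (j - i) + p.length := by omega
        rw [this, Nat.add_mod_right, Nat.mod_eq_of_lt (by omega)] at hij
        omega
      · rw [Nat.mod_eq_of_lt (by omega)] at hij
        omega
    rcases hcase with h | ⟨h, h0⟩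
    · rwa [h]
    · rw [h, SimpleGraph.Walk.getVert_length] at hadj
      rwa [h0, SimpleGraph.Walk.getVert_zero]
  have hto : ∀ i j, (SimpleGraph.cycleGraph p.length).Adj i j → G.Adj (φ i) (φ j) := by
    intro i j hij
    rw [SimpleGraph.cycleGraph_adj'] at hij
    rcases hij with h | h
    · exact (hone j i h).symm
    · exact hone i j h
  refine ⟨p.length, h3, φ, fun i j => ⟨fun hij => ?_, hto i j⟩⟩
  have hcard := SimpleGraph.ncard_neighborSet_cycleGraph h3 i
  -- Both graphs have exactly two neighbours at each vertex, so an adjacency-preserving bijection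
  -- also reflects adjacency.
  have himg : φ '' (SimpleGraph.cycleGraph p.length).neighborSet i = G.neighborSet (φ i) := by
    refine Set.eq_of_subset_of_ncard_le ?_ ?_ (Set.toFinite _)
    · rintro _ ⟨k, hk, rfl⟩
      exact hto i k hk
    · rw [hdeg, Set.ncard_image_of_injective _ φ.injective, hcard]
  have : φ j ∈ φ '' (SimpleGraph.cycleGraph p.length).neighborSet i := by
    rw [himg]
    exact hij
  obtain ⟨k, hk, hkj⟩ := this
  exact φ.injective hkj ▸ hk

theorem SimpleGraph.cycleGraph_adj_parity {n : ℕ} (hn : Even n) {i j : Fin n}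
    (h : (SimpleGraph.cycleGraph n).Adj i j) : ¬ (Even (i : ℕ) ↔ Even (j : ℕ)) := by
  have key : ∀ i j : Fin n, (j - i).val = 1 → ¬ (Even (i : ℕ) ↔ Even (j : ℕ)) := by
    intro i j hij
    have hi := i.isLt
    have hj := j.isLt
    rw [Fin.sub_def] at hij
    simp only at hij
    rw [Nat.even_iff] at *
    rw [Nat.even_iff]
    by_cases hle : (i : ℕ) ≤ j
    · have : n - (i : ℕ) + j = (j - i) + n := by omega
      rw [this, Nat.add_mod_right, Nat.mod_eq_of_lt (by omega)] at hij
      omega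
    · rw [Nat.mod_eq_of_lt (by omega)] at hij
      omega
  rw [SimpleGraph.cycleGraph_adj'] at h
  rcases h with h | h
  · exact fun hh => key j i h hh.symm
  · exact key i j h

end CycleGraph

namespace MultiHypergraph

/-! ### Back to hypergraphs: excluded cases and degree bounds -/

section Partition

open Classical

variable {α β : Type*} {H : MultiHypergraph α β}

theorem Connected.connOff (h : H.Connected) : H.ConnOff H.verts ∅ := by
  intro W hW hne hcl
  rw [Finset.sdiff_empty] at hW ⊢
  by_contra hEq
  obtain ⟨e, he, ⟨u, hu, huW⟩, w, hw, -, hwW⟩ := h.2 W hne (hW.ssubset_of_ne hEq)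
  have := hcl e he (H.inc_subset e he) ⟨u, hu, huW⟩ hw
  rw [Finset.union_empty] at this
  exact hwW this

theorem degreeOn_verts (v : α) : H.degreeOn H.verts v = H.degree v := by
  unfold degreeOn degree
  congr 1
  refine Finset.filter_congr fun e he => ?_
  simp [H.inc_subset e he]

/-- A connected hypergraph that is bad for constant capacities is a multigraph without cut
vertices. -/
theorem Connected.badPair {ι : Type*} [Fintype ι] (h : H.Connected) {k : ι → ℕ} {a b : ι}
    (hab : a ≠ b) (ha : 1 ≤ k a) (hb : 1 ≤ k b) (hbad : H.Bad (fun _ => k) H.verts)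
    (hdeg : H.maxDegree ≤ ∑ i, k i) : H.BadPair (fun _ => k) H.verts := by
  have hconn := h.connOff
  have hdeg' : ∀ v ∈ H.verts, H.degreeOn H.verts v ≤ ∑ i, k i := fun v hv => by
    rw [degreeOn_verts]
    exact (H.degree_le_maxDegree hv).trans hdeg
  have hcard : ∀ e ∈ H.edges, ∀ v ∈ H.inc e, H.ConnOff H.verts {v} → (H.inc e).card = 2 :=
    fun e he v hv hsep => le_antisymm
      (hbad.card_inc_le_two hconn hdeg' he (H.inc_subset e he) hv hsep hab ha hb)
      (H.two_le_card_inc e he)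
  have hnc : H.NoCut H.verts := by
    by_contra hnc
    obtain ⟨X', z', hX'⟩ := exists_lobe_of_not_noCut hconn hnc
    obtain ⟨X, -, z, hX⟩ := hX'.exists_leaf
    obtain ⟨x, hx1, hx2, -, hlt⟩ := hX.1.exists_bad hbad hconn hdeg' ⟨a⟩
    have hB : H.BadPair (Function.update (fun _ => k) z x) (insert z X) := by
      refine ⟨fun e he heB => ?_, hX.noCut hconn, hx1, hx2⟩
      obtain ⟨v, hv, hvz⟩ := exists_ne_of_mem_edges he z
      exact hcard e he v hv
        (hX.connOff hconn ((Finset.mem_insert.1 (heB hv)).resolve_left hvz))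
    obtain ⟨v, hv⟩ := hX.1.nonempty
    have hvz : v ≠ z := ne_of_mem_of_not_mem hv hX.1.notMem
    have hvB : v ∈ insert z X := Finset.mem_insert_of_mem hv
    -- At `v` both `a` and `b` are available, so the end block is not monochromatic; at `z` the
    -- total is strictly smaller, so it is not constant.
    rcases hB.isMono_or_isConst ⟨a⟩ with ⟨j, hj⟩ | hc
    · have hj' := hj v hvB
      simp only [Function.update_of_ne hvz] at hj'
      by_cases haj : a = j
      · have := hj' b fun h' => hab (haj.trans h'.symm)
        omega
      · have := hj' a haj
        omega
    · have := hc v hvB z (Finset.mem_insert_self z X)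
      rw [Function.update_of_ne hvz, Function.update_self] at this
      rw [this] at hlt
      exact lt_irrefl _ hlt
  refine ⟨fun e he _ => ?_, hnc, hbad, hdeg'⟩
  obtain ⟨v, hv, -⟩ := exists_ne_of_mem_edges he (exists_ne_of_mem_edges he h.1.choose).choose
  exact hcard e he v hv (hnc.2 v (H.inc_subset e he hv))

/-- A bad pair all of whose vertices have at most two neighbours is a multiple of an odd cycle. -/
theorem BadPair.isMultiple_cycleGraph {ι : Type*} [Fintype ι] {f : α → ι → ℕ} {a b : ι} {t : ℕ}
    (h : H.BadPair f H.verts) (hab : a ≠ b) (hpos : ∀ v ∈ H.verts, 1 ≤ f v a ∧ 1 ≤ f v b)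
    (h4 : 4 ≤ H.verts.card)
    (hN : ∀ w ∈ H.verts, ∃ p q, ∀ x ∈ H.verts, H.edgeMultiplicity w x ≠ 0 → x = p ∨ x = q)
    (ht : ∀ x ∈ H.verts, ∀ y ∈ H.verts, H.edgeMultiplicity x y ≠ 0 → H.edgeMultiplicity x y = t) :
    ∃ n, 3 ≤ n ∧ Odd n ∧ H.IsMultiple t (SimpleGraph.cycleGraph n) := by
  let G : SimpleGraph H.verts :=
    { Adj := fun x y => H.edgeMultiplicity x y ≠ 0
      symm := ⟨fun x y hxy => by rwa [edgeMultiplicity_comm]⟩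
      loopless := ⟨fun x hx => hx edgeMultiplicity_self⟩ }
  have hG : ∀ x y : H.verts, G.Adj x y ↔ H.edgeMultiplicity x y ≠ 0 := fun _ _ => Iff.rfl
  have hGconn : G.Connected := by
    obtain ⟨v0, hv0⟩ := h.nonempty a
    have hreach : ∀ w : H.verts, G.Reachable ⟨v0, hv0⟩ w := by
      have := h.noCut.1
        (H.verts.filter fun w => ∃ hw : w ∈ H.verts, G.Reachable ⟨v0, hv0⟩ ⟨w, hw⟩) (by simp)
        ⟨v0, by simp [hv0]⟩ (h.uniform.closedOff (by
          intro w hw x hx hm _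
          rw [Finset.mem_filter] at hw ⊢
          obtain ⟨_, hw, hr⟩ := hw
          refine ⟨hx, hx, hr.trans (SimpleGraph.Adj.reachable ?_)⟩
          exact hm))
      intro w
      have hw : (w : α) ∈ H.verts.filter fun w =>
          ∃ hw : w ∈ H.verts, G.Reachable ⟨v0, hv0⟩ ⟨w, hw⟩ := by
        rw [this]
        simp
      exact (Finset.mem_filter.1 hw).2.2
    have : Nonempty H.verts := ⟨⟨v0, hv0⟩⟩
    exact ⟨fun x y => (hreach x).symm.trans (hreach y)⟩
  -- If `u` were the only neighbour of `w`, it would cut off `{w}`; two uses of this give `w` two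
  -- neighbours.
  have hnbr : ∀ w ∈ H.verts, ∀ u ∈ H.verts, u ≠ w →
      ∃ x ∈ H.verts, H.edgeMultiplicity w x ≠ 0 ∧ x ≠ u := by
    intro w hw u hu huw
    by_contra hcon
    push Not at hcon
    have := h.noCut.2 u hu {w} (by simpa using ⟨hw, huw.symm⟩) (Finset.singleton_nonempty w)
      (h.uniform.closedOff (by
        intro w' hw' x hx hm hxu
        rw [Finset.mem_singleton] at hw'
        subst hw'
        exact absurd (by simpa using hcon x hx hm) hxu))
    have hc := congrArg Finset.card this
    rw [Finset.card_singleton, Finset.card_sdiff_of_subset (by simpa using hu),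
      Finset.card_singleton] at hc
    omega
  have hdeg : ∀ v, (G.neighborSet v).ncard = 2 := by
    rintro ⟨w, hw⟩
    obtain ⟨u, hu, huw⟩ := Finset.exists_mem_ne (by omega : 1 < H.verts.card) w
    obtain ⟨x, hx, hwx, -⟩ := hnbr w hw u hu huw
    obtain ⟨y, hy, hwy, hyx⟩ := hnbr w hw x hx (ne_of_edgeMultiplicity_ne_zero hwx).symm
    rw [Set.ncard_eq_two]
    refine ⟨⟨x, hx⟩, ⟨y, hy⟩, fun hh => hyx (congrArg Subtype.val hh).symm, ?_⟩
    obtain ⟨p, q, hpq⟩ := hN w hw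
    ext ⟨s, hs⟩
    simp only [SimpleGraph.mem_neighborSet, hG, Set.mem_insert_iff, Set.mem_singleton_iff,
      Subtype.mk.injEq]
    constructor
    · intro hws
      rcases hpq x hx hwx with rfl | rfl <;> rcases hpq y hy hwy with rfl | rfl <;>
        rcases hpq s hs hws with rfl | rfl <;> simp_all
    · rintro (rfl | rfl)
      · exact hwx
      · exact hwy
  obtain ⟨n, hn, φ, hφ⟩ := hGconn.exists_equiv_cycleGraph hdeg
  refine ⟨n, hn, ?_, fun e he => h.uniform e he (H.inc_subset e he), φ, fun x y => ⟨?_, ?_⟩⟩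
  · rw [← Nat.not_even_iff_odd]
    intro hev
    -- On an even cycle, colouring by parity with `a` and `b` leaves no monochromatic edge, so all
    -- relevant colour degrees are `0` and the colouring is good.
    set c : α → ι := fun w =>
      if hw : w ∈ H.verts then if Even (φ.symm ⟨w, hw⟩ : ℕ) then a else b else a with hc
    apply h.bad c
    rintro U hU ⟨v, hv⟩
    refine ⟨v, hv, ?_⟩
    have hvS := hU hv
    have h0 : H.colourDegree c U (c v) v = 0 := by
      rw [colourDegree, Finset.card_eq_zero, Finset.filter_eq_empty_iff]
      rintro e he ⟨hve, heU, hmono⟩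
      obtain ⟨w, hwe, hwv⟩ := exists_ne_of_mem_edges he v
      have hwS := hU (heU hwe)
      have hm := h.uniform.edgeMultiplicity_ne_zero he (heU.trans hU) hve hwe hwv.symm
      have hadj : (SimpleGraph.cycleGraph n).Adj (φ.symm ⟨v, hvS⟩) (φ.symm ⟨w, hwS⟩) := by
        rw [← hφ, Equiv.apply_symm_apply, Equiv.apply_symm_apply]
        exact hm
      have hpar := SimpleGraph.cycleGraph_adj_parity hev hadj
      have hcol := hmono w hwe hwv
      simp only [hc, hwS, hvS, dif_pos] at hcol
      by_cases h1 : Even (φ.symm ⟨v, hvS⟩ : ℕ) <;> by_cases h2 : Even (φ.symm ⟨w, hwS⟩ : ℕ) <;>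
        simp only [h1, h2, if_true, if_false] at hcol hpar
      · exact hpar trivial
      · exact hab hcol.symm
      · exact hab hcol
      · exact hpar trivial
    rw [h0]
    have := hpos v hvS
    simp only [hc, hvS, dif_pos]
    split_ifs <;> omega
  · intro hxy
    exact ht _ (φ x).2 _ (φ y).2 ((hφ x y).2 hxy)
  · intro _ hxy
    by_contra hm
    exact hxy ((hφ x y).1 hm)

theorem Uniform.isMultiple_top {t : ℕ} (h : H.Uniform H.verts)
    (ht : ∀ x ∈ H.verts, ∀ y ∈ H.verts, x ≠ y → H.edgeMultiplicity x y = t) :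
    H.IsMultiple t (⊤ : SimpleGraph (Fin H.verts.card)) := by
  refine ⟨fun e he => h e he (H.inc_subset e he), H.verts.equivFin.symm, fun x y => ⟨?_, ?_⟩⟩
  · intro hxy
    refine ht _ (Subtype.prop _) _ (Subtype.prop _) fun hh => ?_
    exact hxy (H.verts.equivFin.symm.injective (Subtype.ext hh))
  · intro hxy hn
    exact absurd hxy hn

/-- The subhypergraph induced by a colour class. -/
noncomputable def colourClass {ι : Type*} (H : MultiHypergraph α β) (c : α → ι) (i : ι) :
    MultiHypergraph α β where
  verts := H.verts.filter fun v => c v = i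
  edges := H.edges.filter fun e => H.inc e ⊆ H.verts.filter fun v => c v = i
  inc := H.inc
  inc_subset := fun _ he => (Finset.mem_filter.1 he).2
  two_le_card_inc := fun e he => H.two_le_card_inc e (Finset.mem_filter.1 he).1

theorem mem_verts_colourClass {ι : Type*} {c : α → ι} {i : ι} {v : α} :
    v ∈ (H.colourClass c i).verts ↔ v ∈ H.verts ∧ c v = i :=
  Finset.mem_filter

theorem isPartition_colourClass {p : ℕ} (c : α → Fin p) : H.IsPartition (H.colourClass c) where
  induced i := ⟨⟨fun _ hv => (mem_verts_colourClass.1 hv).1, Finset.filter_subset _ _,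
    fun _ _ => rfl⟩, fun _ he heV => Finset.mem_filter.2 ⟨he, heV⟩⟩
  disjoint i j hij := by
    rw [Finset.disjoint_left]
    intro v hi hj
    exact hij ((mem_verts_colourClass.1 hi).2.symm.trans (mem_verts_colourClass.1 hj).2)
  cover := by
    ext v
    simp [mem_verts_colourClass]

theorem Good.col_colourClass_le {ι : Type*} {k : ι → ℕ} {c : α → ι}
    (hc : H.Good (fun _ => k) c H.verts) (i : ι) : (H.colourClass c i).col ≤ k i := by
  refine Nat.sInf_le fun H' hsub hne => ?_
  obtain ⟨v, hv, hlt⟩ := hc H'.verts (hsub.1.trans (Finset.filter_subset _ _)) hne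
  refine ⟨v, hv, lt_of_le_of_lt ?_ ((Finset.mem_filter.1 (hsub.1 hv)).2 ▸ hlt)⟩
  have hcv : c v = i := (Finset.mem_filter.1 (hsub.1 hv)).2
  refine Finset.card_le_card fun e he => ?_
  simp only [Finset.mem_filter] at he ⊢
  have hinc : H'.inc e = H.inc e := hsub.2.2 e he.1
  have hes := H'.inc_subset e he.1
  rw [hinc] at he hes
  refine ⟨(Finset.mem_filter.1 (hsub.2.1 he.1)).1, he.2, hes, fun w hw _ => ?_⟩
  exact (Finset.mem_filter.1 (hsub.1 (hes hw))).2

theorem maxDegree_colourClass_le {ι : Type*} {k : ι → ℕ} {c : α → ι}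
    (hc : ∀ v ∈ H.verts, H.colourDegree c H.verts (c v) v ≤ k (c v)) (i : ι) :
    (H.colourClass c i).maxDegree ≤ k i := by
  refine Finset.sup_le fun v hv => ?_
  have hv' := Finset.mem_filter.1 hv
  obtain rfl := hv'.2
  refine le_trans (Finset.card_le_card fun e he => ?_) (hc v hv'.1)
  simp only [Finset.mem_filter] at he ⊢
  have he' := Finset.mem_filter.1 he.1
  refine ⟨he'.1, he.2, H.inc_subset e he'.1, fun w hw _ => ?_⟩
  exact (Finset.mem_filter.1 (he'.2 hw)).2

/-- Among the good colourings, one minimizing the number of monochromatic edges corrected by the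
capacities has all colour degrees bounded by the capacities. -/
theorem Good.exists_colourDegree_le {ι : Type*} [Fintype ι] {k : ι → ℕ} {c₀ : α → ι}
    (hc₀ : H.Good (fun _ => k) c₀ H.verts) (hdeg : H.maxDegree ≤ ∑ i, k i) :
    ∃ c, H.Good (fun _ => k) c H.verts ∧
      ∀ v ∈ H.verts, H.colourDegree c H.verts (c v) v ≤ k (c v) := by
  set K := ∑ i, k i with hK
  have hkK : ∀ i, k i ≤ K := fun i =>
    Finset.single_le_sum (f := k) (fun _ _ => Nat.zero_le _) (Finset.mem_univ i)
  let mono : (α → ι) → ℕ := fun c =>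
    (H.edges.filter fun e => ∃ i, ∀ w ∈ H.inc e, c w = i).card
  -- Writing `d i` for colour degrees at `v`, recolouring `v` from `i` to `j` changes `Φ` by `(d j -
  -- k j) - (d i - k i)`; the shift by `K` keeps the weights natural.
  let Φ : (α → ι) → ℕ := fun c => mono c + ∑ v ∈ H.verts, (K - k (c v))
  have hex : ∃ n c, H.Good (fun _ => k) c H.verts ∧ Φ c = n := ⟨_, c₀, hc₀, rfl⟩
  obtain ⟨c, hc, hΦ⟩ := Nat.find_spec hex
  refine ⟨c, hc, fun v hv => ?_⟩
  by_contra hgt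
  push Not at hgt
  -- The colour degrees at `v` sum to at most `K`, so an excess in one colour leaves room in
  -- another.
  obtain ⟨j, hj⟩ : ∃ j, H.colourDegree c H.verts j v < k j := by
    by_contra hcon
    push Not at hcon
    have h1 := sum_colourDegree_le (H := H) c H.verts v
    rw [degreeOn_verts] at h1
    have h2 : K < ∑ i, H.colourDegree c H.verts i v :=
      Finset.sum_lt_sum (fun i _ => hcon i) ⟨c v, Finset.mem_univ _, hgt⟩
    have h3 := H.degree_le_maxDegree hv
    omega
  have hsplit : ∀ c : α → ι, mono c =
      (H.edges.filter fun e => v ∉ H.inc e ∧ ∃ i, ∀ w ∈ H.inc e, c w = i).card +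
        H.colourDegree c H.verts (c v) v := by
    intro c
    simp only [mono, colourDegree]
    rw [← Finset.card_union_of_disjoint]
    · congr 1
      ext e
      simp only [Finset.mem_union, Finset.mem_filter]
      constructor
      · rintro ⟨he, i, hi⟩
        by_cases hve : v ∈ H.inc e
        · exact Or.inr ⟨he, hve, H.inc_subset e he,
            fun w hw _ => (hi w hw).trans (hi v hve).symm⟩
        · exact Or.inl ⟨he, hve, i, hi⟩
      · rintro (⟨he, -, hi⟩ | ⟨he, -, -, hi⟩)
        · exact ⟨he, hi⟩
        · refine ⟨he, c v, fun w hw => ?_⟩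
          by_cases hwv : w = v
          · rw [hwv]
          · exact hi w hw hwv
    · rw [Finset.disjoint_left]
      intro e h1 h2
      exact (Finset.mem_filter.1 h1).2.1 (Finset.mem_filter.1 h2).2.1
  set c' := Function.update c v j with hc'
  have hc'v : c' v = j := Function.update_self _ _ _
  have hc'w : ∀ w, w ≠ v → c' w = c w := fun w hw => Function.update_of_ne hw _ _
  -- Colour degrees of other vertices may grow, but `v` has spare capacity in `j` and can be peeled
  -- first.
  have hgood : H.Good (fun _ => k) c' H.verts := by
    apply Good.of_erase (y := v)
    · exact (hc.subset (Finset.erase_subset v _)).congr fun w hw =>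
        (hc'w w (Finset.ne_of_mem_erase hw)).symm
    · rw [hc'v, hc', colourDegree_update]
      exact hj
  have hrest : (H.edges.filter fun e => v ∉ H.inc e ∧ ∃ i, ∀ w ∈ H.inc e, c' w = i) =
      H.edges.filter fun e => v ∉ H.inc e ∧ ∃ i, ∀ w ∈ H.inc e, c w = i := by
    refine Finset.filter_congr fun e _ => and_congr_right fun hve => ?_
    refine exists_congr fun i => forall_congr' fun w => forall_congr' fun hw => ?_
    rw [hc'w w fun h => hve (h ▸ hw)]
  have hlt : Φ c' < Φ c := by
    have h1 := hsplit c
    have h2 := hsplit c'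
    rw [hrest, hc'v, hc', colourDegree_update, ← hc'] at h2
    have h3 : ∀ c : α → ι, ∑ w ∈ H.verts, (K - k (c w)) =
        (K - k (c v)) + ∑ w ∈ H.verts.erase v, (K - k (c w)) := fun c =>
      (Finset.add_sum_erase _ _ hv).symm
    have h4 : ∑ w ∈ H.verts.erase v, (K - k (c' w)) = ∑ w ∈ H.verts.erase v, (K - k (c w)) :=
      Finset.sum_congr rfl fun w hw => by rw [hc'w w (Finset.ne_of_mem_erase hw)]
    have h5 := h3 c'
    rw [hc'v, h4] at h5
    have h6 := h3 c
    have h7 := hkK j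
    have h8 := hkK (c v)
    simp only [Φ]
    omega
  exact Nat.find_min hex (hΦ ▸ hlt) ⟨c', hgood, rfl⟩

end Partition

end MultiHypergraph

theorem mainTheorem3 {α β : Type*} (H : MultiHypergraph α β) (hconn : H.Connected)
    (hΔ : 1 ≤ H.maxDegree)
    (hK : ¬ ∃ t n : ℕ, 1 ≤ t ∧ 1 ≤ n ∧ H.IsMultiple t (⊤ : SimpleGraph (Fin n)))
    (hC : ¬ ∃ t n : ℕ, 1 ≤ t ∧ 3 ≤ n ∧ Odd n ∧ H.IsMultiple t (SimpleGraph.cycleGraph n))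
    (p : ℕ) (hp : 2 ≤ p) (k : Fin p → ℕ) (hk : ∀ i, 1 ≤ k i) (hsum : H.maxDegree ≤ ∑ i, k i) :
    ∃ P : Fin p → MultiHypergraph α β,
      H.IsPartition P ∧ ∀ i, (P i).col ≤ k i ∧ (P i).maxDegree ≤ k i := by
  by_cases hgood : ∃ c, H.Good (fun _ => k) c H.verts
  · obtain ⟨c₀, hc₀⟩ := hgood
    obtain ⟨c, hc, hle⟩ := hc₀.exists_colourDegree_le hsum
    exact ⟨H.colourClass c, MultiHypergraph.isPartition_colourClass c,
      fun i => ⟨hc.col_colourClass_le i, MultiHypergraph.maxDegree_colourClass_le hle i⟩⟩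
  exfalso
  have hbad : H.Bad (fun _ => k) H.verts := fun c hc => hgood ⟨c, hc⟩
  have hab : (⟨0, by omega⟩ : Fin p) ≠ ⟨1, by omega⟩ := by simp
  have hB := hconn.badPair hab (hk _) (hk _) hbad hsum
  have hpos : ∀ v ∈ H.verts, 1 ≤ k ⟨0, by omega⟩ ∧ 1 ≤ k ⟨1, by omega⟩ :=
    fun _ _ => ⟨hk _, hk _⟩
  obtain ⟨t, ht, htop | ⟨h4, hN, hcyc⟩⟩ := hB.multiplicity_classification hab hpos
  · exact hK ⟨t, H.verts.card, ht, Finset.card_pos.2 hconn.1, hB.uniform.isMultiple_top htop⟩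
  · obtain ⟨n, hn, hodd, hmul⟩ := hB.isMultiple_cycleGraph hab hpos h4 hN hcyc
    exact hC ⟨t, n, ht, hn, hodd, hmul⟩
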